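/- **(Dobrushin Matrix Bounded Differences)** Let $Z=(Z_1,\dots,Z_n)$ be a vector of random variables, not necessarily independent, where $Z_k$ takes values in a Polish space $\mathcal Z_k$ with its Borel $\sigma$-algebra; put $\mathcal Z=\mathcal Z_1\times\dots\times\mathcal Z_n$, and write $x_{-i}$ for the vector $x\in\mathcal Z$ with its $i$th component deleted. Let $D\in\mathbb R^{n\times n}$ be a Dobrushin interdependence matrix for $Z$: $D$ has zero diagonal and there are regular versions $\mu_i(\cdot\mid\cdot)$ of the conditional distributions of $Z_i$ given $Z_{-i}$ such that $$\sup_{B\subset\mathcal Z_i\text{ Borel}}\big|\mu_i(B\mid x_{-i})-\mu_i(B\mid y_{-i})\big|\le\sum_{j=1}^n D_{ij}\,\mathbb 1[x_j\neq y_j]\qquad\text{for every } i \text{ and all } x,y\in\mathcal Z .$$ Let $\|D\|_{p\to p}$ denote the norm of $D$ induced by the $\ell_p$ norm on $\mathbb R^n$, and suppose that $\max\{\|D\|_{1\to1},\|D\|_{\infty\to\infty}\}<1$. Let $d\ge1$, let $H$ be a measurable function from $\mathcal Z$ to the complex Hermitian $d\times d$ matrices, and let $A_1,\dots,A_n$ be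 deterministic Hermitian $d\times d$ matrices with $$\big(H(z_1,\dots,z_n)-H(z_1,\dots,z_j',\dots,z_n)\big)^2\preccurlyeq A_j^2\qquad\text{for every } j,$$ where $z_k,z_k'$ range over the possible values of $Z_k$ for each $k$ (that is, over some measurable set $S_k\subset\mathcal Z_k$ with $\mathbb P(Z_k\in S_k)=1$) and $\preccurlyeq$ is the positive-semidefinite order. Set $$\sigma^2=\Big\|\sum_{j=1}^nA_j^2\Big\|\quad(\sigma\ge0),\qquad b=\Big[1-\tfrac12\big(\|D\|_{1\to1}+\|D\|_{\infty\to\infty}\big)\Big]^{-1},$$ where $\|\cdot\|$ is the spectral norm. Then $\mathbb E H(Z)$ and $\mathbb E\lambda_{\max}(H(Z)-\mathbb E H(Z))$ exist, and for all $t\ge0$ $$\mathbb P\big(\lambda_{\max}(H(Z)-\mathbb E H(Z))\ge t\big)\le d\cdot e^{-t^2/(b\sigma^2)},$$ where for $\sigma=0$ the exponential is read as $0$ if $t>0$ and as $1$ if $t=0$. Furthermore, $$\mathbb E\,\lambda_{\max}\big(H(Z)-\mathbb E H(Z)\big)\le\sigma\sqrt{b\log d}.$$ -/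

import Mathlib

open MeasureTheory ProbabilityTheory
open scoped ENNReal Matrix ComplexOrder MatrixOrder

noncomputable section

/-- The total variation distance `sup_A |ν(A) - μ(A)|`, the supremum being over all measurable
sets `A`. (For probability measures the family is bounded by `1`.) -/
def tvDist {E : Type*} [MeasurableSpace E] (ν μ : Measure E) : ℝ :=
  ⨆ A : {A : Set E // MeasurableSet A}, |ν.real A - μ.real A|

/-- The vector `x_{-i}`: the vector `x` with its `i`-th component deleted. -/
def deleteCoord {n : ℕ} {E : Fin n → Type*} (i : Fin n) (x : ∀ k, E k) :
    ∀ k : {k : Fin n // k ≠ i}, E k :=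
  fun k => x k

/-- `D` is a Dobrushin interdependence matrix for the random vector `Z = (Z_1, …, Z_n)`, where
`Z_k` takes values in `E k`: the diagonal of `D` vanishes and the conditional distributions
`μ_i(· | Z_{-i})` (that is, some choice of regular versions `κ i` of them) satisfy
`TV(μ_i(· | x_{-i}), μ_i(· | y_{-i})) ≤ ∑_j D_ij 1[x_j ≠ y_j]` for every index `i` and all
vectors `x`, `y`. -/
def IsDobrushinMatrix {Ω : Type*} [MeasurableSpace Ω] (P : Measure Ω) {n : ℕ}
    {E : Fin n → Type*} [∀ k, MeasurableSpace (E k)] (Z : ∀ k, Ω → E k)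
    (D : Matrix (Fin n) (Fin n) ℝ) : Prop :=
  (∀ i, D i i = 0) ∧
  ∃ κ : ∀ i : Fin n, Kernel (∀ k : {k : Fin n // k ≠ i}, E k) (E i),
    (∀ i, IsMarkovKernel (κ i)) ∧
    (∀ i, HasCondDistrib (Z i) (fun ω => deleteCoord i (fun k => Z k ω)) (κ i) P) ∧
    ∀ (i : Fin n) (x y : ∀ k, E k),
      tvDist (κ i (deleteCoord i x)) (κ i (deleteCoord i y)) ≤
        ∑ j, D i j * ({j | x j ≠ y j} : Set (Fin n)).indicator 1 j

/-- The norm `‖B‖_{p → p}` of a real square matrix: the operator norm of `x ↦ B x` on `ℝⁿ` with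
the `ℓ_p` norm. -/
def inducedNorm {n : ℕ} (p : ℝ≥0∞) [Fact (1 ≤ p)] (B : Matrix (Fin n) (Fin n) ℝ) : ℝ :=
  ‖LinearMap.toContinuousLinearMap (Matrix.toLpLin p p B)‖

/-- The spectral norm of a complex square matrix: its operator norm on `ℂᵈ` with the Euclidean
norm. -/
def specNorm {d : ℕ} (B : Matrix (Fin d) (Fin d) ℂ) : ℝ :=
  ‖Matrix.toEuclideanCLM (n := Fin d) (𝕜 := ℂ) B‖

/-- The largest eigenvalue of a Hermitian matrix of positive size (the spectrum is then a finite
nonempty set of reals). -/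
def lambdaMax {d : ℕ} (B : Matrix (Fin d) (Fin d) ℂ) : ℝ := sSup (spectrum ℝ B)

/-- The entrywise expectation of a random matrix. -/
def expect {Ω : Type*} [MeasurableSpace Ω] (P : Measure Ω) {d : ℕ}
    (X : Ω → Matrix (Fin d) (Fin d) ℂ) : Matrix (Fin d) (Fin d) ℂ :=
  Matrix.of fun a b => ∫ ω, X ω a b ∂P

end

/-! The argument is the method of exchangeable pairs for matrices. Resampling one coordinate of `Z`
from its conditional law produces an exchangeable pair (`integral_resample_comm`). Resampling a
uniformly chosen coordinate is the Gibbs sampler; its transition operator Γ (`gibbs`) preserves the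
law of `Z`. Let h be `H` minus its mean. The Dobrushin condition forces Γ^m h → 0 uniformly, so h is
the telescoping sum of the differences Γ^m h - Γ^(m+1) h.

Put g = Γ^m h and let primes denote values after resampling. Exchangeability turns E tr((g - Γg)
e^{θh}) into half the average over j of E tr((g - g')(e^{θh} - e^{θh'})), and
`trace_mul_exp_sub_exp_le` bounds this by the squares (h - h')² and (g - g')². The first is at most
A_j². For the second, Γ acts on vectors of coordinatewise oscillations through the nonnegative
matrix M = `gibbsMatrix D`, so it is controlled by the A_k² weighted with the entries of M^m
(`sq_iterate_gibbs_sub_le`). The row and column sums of M are at most 1 - (1 - ‖D‖₁)/n and 1 - (1 -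
‖D‖_∞)/n, whose product is at most ρ² with ρ = 1 - 1/(bn). The m-th term therefore carries a factor
ρ^m/n, and the geometric series gives E tr(h e^{θh}) ≤ (θ/2) b σ² E tr e^{θh}, free of n
(`integral_trace_mul_exp_le`).

The left side is the θ-derivative of E tr e^{θh}. Integration yields E tr e^{θh} ≤ d e^{bσ²θ²/4},
from which the tail and mean bounds follow by optimizing θ. The sets `S k` are handled by composing
`H` with a retraction onto their product. -/

/-! ### Traces of matrix exponentials and the mean value trace inequality. -/

section TraceInequalities

variable {d : ℕ}

lemma sinh_le_mul_cosh {x : ℝ} (hx : 0 ≤ x) : Real.sinh x ≤ x * Real.cosh x := by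
  have hmono : MonotoneOn (fun y : ℝ => y * Real.cosh y - Real.sinh y) (Set.Ici 0) := by
    apply monotoneOn_of_deriv_nonneg (convex_Ici 0) (by fun_prop) (by fun_prop)
    intro y hy
    have hd : HasDerivAt (fun y : ℝ => y * Real.cosh y - Real.sinh y)
        (1 * Real.cosh y + y * Real.sinh y - Real.cosh y) y :=
      ((hasDerivAt_id y).mul (Real.hasDerivAt_cosh y)).sub (Real.hasDerivAt_sinh y)
    rw [hd.deriv]
    simp only [interior_Ici, Set.mem_Ioi] at hy
    have := mul_nonneg hy.le (Real.sinh_nonneg_iff.2 hy.le)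
    linarith
  have := hmono (Set.mem_Ici.2 le_rfl) (Set.mem_Ici.2 hx) hx
  simp at this
  linarith

/-- With e^{(a+b)/2} factored out, the left side is 2 sinh u and the right side 2u cosh u, where u =
(a - b)/2. -/
lemma exp_sub_exp_le {a b : ℝ} (hab : b ≤ a) :
    Real.exp a - Real.exp b ≤ (a - b) * ((Real.exp a + Real.exp b) / 2) := by
  have h := sinh_le_mul_cosh (x := (a - b) / 2) (by linarith)
  have ha : Real.exp a = Real.exp ((a + b) / 2) * Real.exp ((a - b) / 2) := by
    rw [← Real.exp_add]; ring_nf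
  have hb : Real.exp b = Real.exp ((a + b) / 2) * Real.exp (-((a - b) / 2)) := by
    rw [← Real.exp_add]; ring_nf
  rw [Real.sinh_eq, Real.cosh_eq] at h
  rw [ha, hb]
  have := mul_le_mul_of_nonneg_left h (Real.exp_pos ((a + b) / 2)).le
  nlinarith

/-- The arithmetic mean of the values of `exp` dominates its divided difference. -/
lemma abs_exp_sub_exp_le (a b : ℝ) :
    |Real.exp a - Real.exp b| ≤ |a - b| * ((Real.exp a + Real.exp b) / 2) := by
  rcases le_total b a with h | h
  · rw [abs_of_nonneg (sub_nonneg.2 (Real.exp_le_exp.2 h)), abs_of_nonneg (sub_nonneg.2 h)]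
    exact exp_sub_exp_le h
  · rw [abs_sub_comm, abs_sub_comm a b, abs_of_nonneg (sub_nonneg.2 (Real.exp_le_exp.2 h)),
      abs_of_nonneg (sub_nonneg.2 h), add_comm]
    exact exp_sub_exp_le h

lemma Matrix.IsHermitian.exists_unitary_exp {A : Matrix (Fin d) (Fin d) ℂ} (hA : A.IsHermitian) :
    ∃ U : Matrix (Fin d) (Fin d) ℂ, Uᴴ * U = 1 ∧ U * Uᴴ = 1 ∧
      A = U * Matrix.diagonal (fun i => (hA.eigenvalues i : ℂ)) * Uᴴ ∧
      ∀ θ : ℝ, NormedSpace.exp (θ • A) =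
        U * Matrix.diagonal (fun i => (Real.exp (θ * hA.eigenvalues i) : ℂ)) * Uᴴ := by
  refine ⟨(hA.eigenvectorUnitary : Matrix (Fin d) (Fin d) ℂ), ?_, ?_, ?_, fun θ => ?_⟩
  · exact Unitary.coe_star_mul_self hA.eigenvectorUnitary
  · exact Unitary.coe_mul_star_self hA.eigenvectorUnitary
  · exact hA.spectral_theorem
  · set U : Matrix (Fin d) (Fin d) ℂ := hA.eigenvectorUnitary.1 with hU
    have hUU : Uᴴ * U = 1 := Unitary.coe_star_mul_self hA.eigenvectorUnitary
    have hUU' : U * Uᴴ = 1 := Unitary.coe_mul_star_self hA.eigenvectorUnitary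
    have hinv : U⁻¹ = Uᴴ := Matrix.inv_eq_right_inv hUU'
    have hdec : θ • A = U * Matrix.diagonal (fun i => ((θ * hA.eigenvalues i : ℝ) : ℂ)) * U⁻¹ := by
      have h1 : A = U * Matrix.diagonal (fun i => (hA.eigenvalues i : ℂ)) * Uᴴ :=
        hA.spectral_theorem
      have h2 : Matrix.diagonal (fun i => ((θ * hA.eigenvalues i : ℝ) : ℂ)) =
          θ • Matrix.diagonal (fun i => (hA.eigenvalues i : ℂ)) := by
        rw [← Matrix.diagonal_smul]
        congr 1
        ext i
        simp
      rw [h2, hinv, Matrix.mul_smul, Matrix.smul_mul, ← h1]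
    rw [hdec, Matrix.exp_conj _ _ (IsUnit.of_mul_eq_one _ hUU'), Matrix.exp_diagonal, hinv]
    congr 3
    ext i
    simp [Pi.coe_exp, Complex.ofReal_exp, Complex.exp_eq_exp_ℂ]

/-- The trace of `exp (θ A)` in terms of the eigenvalues of `A`. -/
lemma Matrix.IsHermitian.trace_exp {A : Matrix (Fin d) (Fin d) ℂ} (hA : A.IsHermitian) (θ : ℝ) :
    (NormedSpace.exp (θ • A)).trace.re = ∑ i, Real.exp (θ * hA.eigenvalues i) := by
  obtain ⟨U, hU, -, -, hexp⟩ := hA.exists_unitary_exp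
  rw [hexp, Matrix.trace_mul_cycle, hU, one_mul, Matrix.trace_diagonal, Complex.re_sum]
  exact Finset.sum_congr rfl fun i _ => Complex.ofReal_re _

lemma Matrix.IsHermitian.trace_mul_exp {A : Matrix (Fin d) (Fin d) ℂ} (hA : A.IsHermitian)
    (θ : ℝ) : (A * NormedSpace.exp (θ • A)).trace.re =
      ∑ i, hA.eigenvalues i * Real.exp (θ * hA.eigenvalues i) := by
  obtain ⟨U, hU, -, hdec, hexp⟩ := hA.exists_unitary_exp
  rw [hexp]
  nth_rw 1 [hdec]
  have : U * Matrix.diagonal (fun i => (hA.eigenvalues i : ℂ)) * Uᴴ *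
      (U * Matrix.diagonal (fun i => (Real.exp (θ * hA.eigenvalues i) : ℂ)) * Uᴴ) =
      U * Matrix.diagonal (fun i => ((hA.eigenvalues i * Real.exp (θ * hA.eigenvalues i) : ℝ) : ℂ))
        * Uᴴ := by
    calc _ = U * Matrix.diagonal (fun i => (hA.eigenvalues i : ℂ)) * (Uᴴ * U) *
          Matrix.diagonal (fun i => (Real.exp (θ * hA.eigenvalues i) : ℂ)) * Uᴴ := by
            simp only [Matrix.mul_assoc]
      _ = _ := by
        rw [hU, mul_one, mul_assoc U, Matrix.diagonal_mul_diagonal]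
        simp only [Complex.ofReal_mul]
  rw [this, Matrix.trace_mul_cycle, hU, one_mul, Matrix.trace_diagonal, Complex.re_sum]
  exact Finset.sum_congr rfl fun i _ => Complex.ofReal_re _

lemma Matrix.IsHermitian.posSemidef_exp {A : Matrix (Fin d) (Fin d) ℂ} (hA : A.IsHermitian) :
    (NormedSpace.exp A).PosSemidef := by
  obtain ⟨U, -, -, -, hexp⟩ := hA.exists_unitary_exp
  have := hexp 1
  rw [one_smul] at this
  rw [this]
  refine Matrix.PosSemidef.mul_mul_conjTranspose_same (Matrix.PosSemidef.diagonal fun i => ?_) U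
  simpa using (Complex.zero_le_real.2 (Real.exp_pos (1 * hA.eigenvalues i)).le)

/-- Writing B = CᴴC and cycling the trace gives tr(C A Cᴴ), the trace of a positive semidefinite
matrix. -/
lemma Matrix.PosSemidef.trace_mul_re_nonneg {A B : Matrix (Fin d) (Fin d) ℂ} (hA : A.PosSemidef)
    (hB : B.PosSemidef) : 0 ≤ (A * B).trace.re := by
  obtain ⟨C, rfl⟩ := CStarAlgebra.nonneg_iff_eq_star_mul_self.1 hB.nonneg
  rw [← Matrix.mul_assoc, Matrix.trace_mul_comm, ← Matrix.mul_assoc]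
  exact (Complex.le_def.1 (hA.mul_mul_conjTranspose_same C).trace_nonneg).1

lemma trace_mul_re_mono {A B C : Matrix (Fin d) (Fin d) ℂ} (hAB : A ≤ B) (hC : C.PosSemidef) :
    (A * C).trace.re ≤ (B * C).trace.re := by
  have := Matrix.PosSemidef.trace_mul_re_nonneg (Matrix.le_iff.1 hAB) hC
  rw [Matrix.sub_mul, Matrix.trace_sub, Complex.sub_re] at this
  linarith

lemma trace_diagonal_mul_mul_conjTranspose (G : Matrix (Fin d) (Fin d) ℂ) (a : Fin d → ℝ) :
    (G * Matrix.diagonal (fun i => (a i : ℂ)) * Gᴴ).trace.re =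
      ∑ i, ∑ j, ‖G i j‖ ^ 2 * a j := by
  simp only [Matrix.trace, Matrix.diag, Matrix.mul_apply (M := G * _), Matrix.mul_diagonal,
    Complex.re_sum, Matrix.conjTranspose_apply]
  refine Finset.sum_congr rfl fun i _ => Finset.sum_congr rfl fun j _ => ?_
  have : G i j * (a j : ℂ) * star (G i j) = ((‖G i j‖ ^ 2 * a j : ℝ) : ℂ) := by
    rw [mul_right_comm, Complex.star_def, Complex.mul_conj, Complex.normSq_eq_norm_sq]
    push_cast; ring
  rw [this, Complex.ofReal_re]

/-- One factor X is cycled to the end and V Vᴴ inserted after it. The basis V may differ from U, so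
traces against exp A and exp B can be read in the same pair of eigenbases. -/
lemma trace_sq_mul_conj {X U V M : Matrix (Fin d) (Fin d) ℂ} (hX : X.IsHermitian)
    (hV : V * Vᴴ = 1) :
    (X ^ 2 * (U * M * Uᴴ)).trace = ((Vᴴ * X * U) * M * (Vᴴ * X * U)ᴴ).trace := by
  rw [pow_two, Matrix.mul_assoc X X, Matrix.trace_mul_comm, ← Matrix.mul_one (_ * X), ← hV,
    ← Matrix.mul_assoc _ V, Matrix.trace_mul_comm, Matrix.conjTranspose_mul,
    Matrix.conjTranspose_mul, hX.eq, Matrix.conjTranspose_conjTranspose]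
  simp only [← Matrix.mul_assoc]

/-- The mean value trace inequality for the exponential function. -/
theorem trace_mul_exp_sub_exp_le {A B C : Matrix (Fin d) (Fin d) ℂ} (hA : A.IsHermitian)
    (hB : B.IsHermitian) (hC : C.IsHermitian) {s : ℝ} (hs : 0 < s) :
    (C * (NormedSpace.exp A - NormedSpace.exp B)).trace.re ≤
      1 / 4 * ((s • (A - B) ^ 2 + s⁻¹ • C ^ 2) *
        (NormedSpace.exp A + NormedSpace.exp B)).trace.re := by
  obtain ⟨U, hU, hU', hAdec, hAexp⟩ := hA.exists_unitary_exp
  obtain ⟨V, hV, hV', hBdec, hBexp⟩ := hB.exists_unitary_exp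
  replace hAexp := hAexp 1
  replace hBexp := hBexp 1
  simp only [one_smul, one_mul] at hAexp hBexp
  set a := hA.eigenvalues
  set b := hB.eigenvalues
  -- quadratic traces in the pair of eigenbases
  have quad : ∀ X : Matrix (Fin d) (Fin d) ℂ, X.IsHermitian →
      (X ^ 2 * (NormedSpace.exp A + NormedSpace.exp B)).trace.re =
        ∑ i, ∑ j, ‖(Uᴴ * X * V) i j‖ ^ 2 * (Real.exp (a i) + Real.exp (b j)) := by
    intro X hX
    have h1 : (X ^ 2 * NormedSpace.exp A).trace.re =
        ∑ i, ∑ j, ‖(Uᴴ * X * V) i j‖ ^ 2 * Real.exp (a i) := by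
      rw [hAexp, trace_sq_mul_conj hX hV', trace_diagonal_mul_mul_conjTranspose, Finset.sum_comm]
      refine Finset.sum_congr rfl fun i _ => Finset.sum_congr rfl fun j _ => ?_
      have hsym : Uᴴ * X * V = (Vᴴ * X * U)ᴴ := by
        rw [Matrix.conjTranspose_mul, Matrix.conjTranspose_mul, hX.eq,
          Matrix.conjTranspose_conjTranspose, Matrix.mul_assoc]
      rw [hsym, Matrix.conjTranspose_apply, norm_star]
    have h2 : (X ^ 2 * NormedSpace.exp B).trace.re =
        ∑ i, ∑ j, ‖(Uᴴ * X * V) i j‖ ^ 2 * Real.exp (b j) := by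
      rw [hBexp, trace_sq_mul_conj hX hU', trace_diagonal_mul_mul_conjTranspose]
    rw [Matrix.mul_add, Matrix.trace_add, Complex.add_re, h1, h2, ← Finset.sum_add_distrib]
    refine Finset.sum_congr rfl fun i _ => ?_
    rw [← Finset.sum_add_distrib]
    exact Finset.sum_congr rfl fun j _ => by ring
  rw [Matrix.add_mul, Matrix.smul_mul, Matrix.smul_mul, Matrix.trace_add, Matrix.trace_smul,
    Matrix.trace_smul, Complex.add_re, Complex.smul_re, Complex.smul_re, quad _ (hA.sub hB),
    quad _ hC]
  -- the bilinear trace in the pair of eigenbases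
  have hdiff : ∀ f : ℝ → ℝ, ∀ i j,
      (Uᴴ * (U * Matrix.diagonal (fun i => (f (a i) : ℂ)) * Uᴴ -
        V * Matrix.diagonal (fun i => (f (b i) : ℂ)) * Vᴴ) * V) i j =
        ((f (a i) - f (b j) : ℝ) : ℂ) * (Uᴴ * V) i j := by
    intro f i j
    have : Uᴴ * (U * Matrix.diagonal (fun i => (f (a i) : ℂ)) * Uᴴ -
        V * Matrix.diagonal (fun i => (f (b i) : ℂ)) * Vᴴ) * V =
        Matrix.diagonal (fun i => (f (a i) : ℂ)) * (Uᴴ * V) -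
          (Uᴴ * V) * Matrix.diagonal (fun i => (f (b i) : ℂ)) := by
      rw [Matrix.mul_sub, Matrix.sub_mul]
      simp only [← Matrix.mul_assoc]
      rw [hU, Matrix.one_mul, Matrix.mul_assoc _ Vᴴ V, hV, Matrix.mul_one]
    rw [this, Matrix.sub_apply, Matrix.diagonal_mul, Matrix.mul_diagonal]
    push_cast
    ring
  have hAB : ∀ i j, ‖(Uᴴ * (A - B) * V) i j‖ = |a i - b j| * ‖(Uᴴ * V) i j‖ := by
    intro i j
    have := hdiff id i j
    simp only [id] at this
    rw [← hAdec, ← hBdec] at this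
    rw [this, norm_mul, Complex.norm_real, Real.norm_eq_abs]
  have hE : ∀ i j, ‖(Uᴴ * (NormedSpace.exp A - NormedSpace.exp B) * V) i j‖ =
      |Real.exp (a i) - Real.exp (b j)| * ‖(Uᴴ * V) i j‖ := by
    intro i j
    have := hdiff Real.exp i j
    rw [← hAexp, ← hBexp] at this
    rw [this, norm_mul, Complex.norm_real, Real.norm_eq_abs]
  have htr : (C * (NormedSpace.exp A - NormedSpace.exp B)).trace =
      ∑ i, ∑ j, star ((Uᴴ * C * V) i j) *
        (Uᴴ * (NormedSpace.exp A - NormedSpace.exp B) * V) i j := by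
    have h1 : (C * (NormedSpace.exp A - NormedSpace.exp B)).trace =
        ((Uᴴ * C * V)ᴴ * (Uᴴ * (NormedSpace.exp A - NormedSpace.exp B) * V)).trace := by
      rw [Matrix.conjTranspose_mul, Matrix.conjTranspose_mul, hC.eq,
          Matrix.conjTranspose_conjTranspose]
      calc _ = (C * (U * Uᴴ) * (NormedSpace.exp A - NormedSpace.exp B) * (V * Vᴴ)).trace := by
            rw [hU', hV', mul_one, mul_one]
        _ = _ := by
          rw [← Matrix.mul_assoc _ V, Matrix.trace_mul_comm]
          simp only [← Matrix.mul_assoc]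
    rw [h1, Finset.sum_comm]
    simp only [Matrix.trace, Matrix.diag, Matrix.mul_apply (M := (Uᴴ * C * V)ᴴ),
      Matrix.conjTranspose_apply]
  calc (C * (NormedSpace.exp A - NormedSpace.exp B)).trace.re
      ≤ ‖(C * (NormedSpace.exp A - NormedSpace.exp B)).trace‖ := Complex.re_le_norm _
    _ ≤ ∑ i, ∑ j, ‖(Uᴴ * C * V) i j‖ * (|Real.exp (a i) - Real.exp (b j)| * ‖(Uᴴ * V) i j‖) := by
        rw [htr]
        refine (norm_sum_le _ _).trans (Finset.sum_le_sum fun i _ => ?_)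
        refine (norm_sum_le _ _).trans (Finset.sum_le_sum fun j _ => ?_)
        rw [norm_mul, norm_star, hE]
    _ ≤ ∑ i, ∑ j, 1 / 4 * (s * (‖(Uᴴ * (A - B) * V) i j‖ ^ 2 * (Real.exp (a i) + Real.exp (b j))) +
          s⁻¹ * (‖(Uᴴ * C * V) i j‖ ^ 2 * (Real.exp (a i) + Real.exp (b j)))) := by
        refine Finset.sum_le_sum fun i _ => Finset.sum_le_sum fun j _ => ?_
        set x := ‖(Uᴴ * C * V) i j‖
        set y := ‖(Uᴴ * (A - B) * V) i j‖ with hy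
        -- In the pair of eigenbases, A - B and exp A - exp B both have entries a scalar difference
        -- times the same overlap (UᴴV)_ij, so the matrix inequality reduces to the scalar one entry
        -- by entry.
        have h1 : |Real.exp (a i) - Real.exp (b j)| * ‖(Uᴴ * V) i j‖ ≤
            y * ((Real.exp (a i) + Real.exp (b j)) / 2) := by
          rw [hy, hAB, mul_right_comm]
          exact mul_le_mul_of_nonneg_right (abs_exp_sub_exp_le _ _) (norm_nonneg _)
        have h2 : x * y ≤ 1 / 2 * (s * y ^ 2 + s⁻¹ * x ^ 2) := by
          have h3 : 0 ≤ s⁻¹ * (s * y - x) ^ 2 := by positivity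
          have h4 : s⁻¹ * (s * y - x) ^ 2 = s * y ^ 2 - 2 * (x * y) + s⁻¹ * x ^ 2 := by
            field_simp
            ring
          linarith
        have hpos : 0 < Real.exp (a i) + Real.exp (b j) := by positivity
        calc _ ≤ x * (y * ((Real.exp (a i) + Real.exp (b j)) / 2)) :=
              mul_le_mul_of_nonneg_left h1 (norm_nonneg _)
          _ = (x * y) * ((Real.exp (a i) + Real.exp (b j)) / 2) := by ring
          _ ≤ (1 / 2 * (s * y ^ 2 + s⁻¹ * x ^ 2)) * ((Real.exp (a i) + Real.exp (b j)) / 2) := by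
              gcongr
          _ = _ := by ring
    _ = _ := by
        simp only [Finset.mul_sum, Finset.sum_add_distrib, mul_add, smul_eq_mul]

end TraceInequalities

/-! ### The largest eigenvalue and the trace exponential. -/

section LargestEigenvalue

variable {d : ℕ} {A : Matrix (Fin d) (Fin d) ℂ}

lemma Matrix.IsHermitian.lambdaMax_eq (hA : A.IsHermitian) :
    lambdaMax A = ⨆ i, hA.eigenvalues i := by
  rw [lambdaMax, hA.spectrum_real_eq_range_eigenvalues, iSup]

lemma Matrix.IsHermitian.eigenvalues_le_lambdaMax (hA : A.IsHermitian) (i : Fin d) :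
    hA.eigenvalues i ≤ lambdaMax A := by
  rw [hA.lambdaMax_eq]
  exact le_ciSup (Set.finite_range hA.eigenvalues).bddAbove i

lemma Matrix.IsHermitian.exists_eigenvalues_eq_lambdaMax (hd : 1 ≤ d) (hA : A.IsHermitian) :
    ∃ i, hA.eigenvalues i = lambdaMax A := by
  have : Nonempty (Fin d) := ⟨⟨0, hd⟩⟩
  rw [hA.lambdaMax_eq]
  exact exists_eq_ciSup_of_finite

/-- The trace is a sum of positive terms, one of which is the left side; `1 ≤ d` ensures that the
maximum is attained. -/
lemma Matrix.IsHermitian.exp_lambdaMax_le (hd : 1 ≤ d) (hA : A.IsHermitian) (θ : ℝ) :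
    Real.exp (θ * lambdaMax A) ≤ (NormedSpace.exp (θ • A)).trace.re := by
  obtain ⟨i, hi⟩ := hA.exists_eigenvalues_eq_lambdaMax hd
  rw [hA.trace_exp, ← hi]
  exact Finset.single_le_sum (f := fun i => Real.exp (θ * hA.eigenvalues i))
    (fun _ _ => (Real.exp_pos _).le) (Finset.mem_univ i)

lemma Matrix.IsHermitian.trace_exp_le (hA : A.IsHermitian) {θ : ℝ} (hθ : 0 ≤ θ) :
    (NormedSpace.exp (θ • A)).trace.re ≤ d * Real.exp (θ * lambdaMax A) := by
  rw [hA.trace_exp]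
  calc _ ≤ ∑ _i : Fin d, Real.exp (θ * lambdaMax A) := by
        gcongr with i
        exact hA.eigenvalues_le_lambdaMax i
    _ = _ := by simp

end LargestEigenvalue

/-! ### Consequences of order relations between squares. -/

section SquareBounds

open scoped Matrix.Norms.L2Operator

variable {d : ℕ} {A : Matrix (Fin d) (Fin d) ℂ}

lemma Matrix.IsHermitian.abs_eigenvalues_le_norm (hA : A.IsHermitian) (i : Fin d) :
    |hA.eigenvalues i| ≤ ‖A‖ := by
  have h := Matrix.l2_opNorm_mulVec A (hA.eigenvectorBasis i)
  have h1 : (EuclideanSpace.equiv (Fin d) ℂ).symm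
    (hA.eigenvalues i • (hA.eigenvectorBasis i).ofLp) =
      hA.eigenvalues i • hA.eigenvectorBasis i := rfl
  rw [hA.mulVec_eigenvectorBasis, h1, norm_smul] at h
  simpa using h

lemma norm_toEuclideanCLM_sq {M : Matrix (Fin d) (Fin d) ℂ} (hM : M.IsHermitian)
    (u : EuclideanSpace ℂ (Fin d)) :
    ‖Matrix.toEuclideanCLM (𝕜 := ℂ) M u‖ ^ 2 = (star u.ofLp ⬝ᵥ (M ^ 2 *ᵥ u.ofLp)).re := by
  rw [← inner_self_eq_norm_sq (𝕜 := ℂ), EuclideanSpace.inner_eq_star_dotProduct,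
    Matrix.ofLp_toEuclideanCLM, pow_two, ← Matrix.mulVec_mulVec, Matrix.star_mulVec, hM.eq,
    Matrix.dotProduct_mulVec, dotProduct_comm]
  rfl

/-- Since u*M²u = ‖Mu‖², the order on squares is a comparison of ‖Mu‖ and ‖Au‖ for every u. In this
form it is compatible with the triangle inequality and with averaging. -/
lemma norm_toEuclideanCLM_le_of_sq_le {M : Matrix (Fin d) (Fin d) ℂ} (hM : M.IsHermitian)
    (hA : A.IsHermitian) (h : M ^ 2 ≤ A ^ 2) (u : EuclideanSpace ℂ (Fin d)) :
    ‖Matrix.toEuclideanCLM (𝕜 := ℂ) M u‖ ≤ ‖Matrix.toEuclideanCLM (𝕜 := ℂ) A u‖ := by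
  rw [← pow_le_pow_iff_left₀ (norm_nonneg _) (norm_nonneg _) two_ne_zero,
    norm_toEuclideanCLM_sq hM, norm_toEuclideanCLM_sq hA]
  have := (Matrix.le_iff.1 h).re_dotProduct_nonneg u.ofLp
  rw [Matrix.sub_mulVec, dotProduct_sub, map_sub, sub_nonneg] at this
  exact this

lemma norm_le_of_sq_le {M : Matrix (Fin d) (Fin d) ℂ} (hM : M.IsHermitian)
    (hA : A.IsHermitian) (h : M ^ 2 ≤ A ^ 2) : ‖M‖ ≤ ‖A‖ := by
  rw [Matrix.cstar_norm_def, Matrix.cstar_norm_def]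
  refine ContinuousLinearMap.opNorm_le_bound _ (norm_nonneg _) fun u => ?_
  exact (norm_toEuclideanCLM_le_of_sq_le hM hA h u).trans (ContinuousLinearMap.le_opNorm _ _)

/-- Cauchy–Schwarz for the square of a matrix dominated by a weighted family of Hermitian
matrices. -/
lemma sq_le_sum_smul_sq {ι : Type*} (s : Finset ι) {M : Matrix (Fin d) (Fin d) ℂ}
    (hM : M.IsHermitian) {A : ι → Matrix (Fin d) (Fin d) ℂ} (hA : ∀ k, (A k).IsHermitian)
    {w : ι → ℝ} (hw : ∀ k, 0 ≤ w k)
    (h : ∀ u : EuclideanSpace ℂ (Fin d), ‖Matrix.toEuclideanCLM (𝕜 := ℂ) M u‖ ≤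
      ∑ k ∈ s, w k * ‖Matrix.toEuclideanCLM (𝕜 := ℂ) (A k) u‖) :
    M ^ 2 ≤ (∑ k ∈ s, w k) • ∑ k ∈ s, w k • A k ^ 2 := by
  have hsq : ∀ k, (A k ^ 2).IsHermitian := fun k => (hA k).pow 2
  have hC : ((∑ k ∈ s, w k) • ∑ k ∈ s, w k • A k ^ 2).IsHermitian := by
    refine IsSelfAdjoint.smul (.all _) ?_
    exact isSelfAdjoint_sum s fun k _ => IsSelfAdjoint.smul (.all _) (hsq k)
  rw [Matrix.le_iff, Matrix.posSemidef_iff_dotProduct_mulVec]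
  refine ⟨hC.sub (hM.pow 2), fun u => ?_⟩
  have him : (star u ⬝ᵥ (((∑ k ∈ s, w k) • ∑ k ∈ s, w k • A k ^ 2) - M ^ 2) *ᵥ u).im = 0 :=
    (hC.sub (hM.pow 2)).im_star_dotProduct_mulVec_self u
  rw [Complex.le_def]
  refine ⟨?_, him.symm⟩
  have key : ‖Matrix.toEuclideanCLM (𝕜 := ℂ) M (WithLp.toLp 2 u)‖ ^ 2 ≤ (∑ k ∈ s, w k) *
      ∑ k ∈ s, w k * ‖Matrix.toEuclideanCLM (𝕜 := ℂ) (A k) (WithLp.toLp 2 u)‖ ^ 2 := by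
    refine (pow_le_pow_left₀ (norm_nonneg _) (h _) 2).trans ?_
    refine Finset.sum_sq_le_sum_mul_sum_of_sq_le_mul s (fun k _ => hw k)
      (fun k _ => mul_nonneg (hw k) (sq_nonneg _)) fun k _ => le_of_eq ?_
    ring
  rw [norm_toEuclideanCLM_sq hM] at key
  simp only [norm_toEuclideanCLM_sq (hA _)] at key
  rw [Matrix.sub_mulVec, dotProduct_sub, Complex.sub_re, Complex.zero_re, sub_nonneg,
    Matrix.smul_mulVec, dotProduct_smul, Matrix.sum_mulVec, dotProduct_sum]
  simp only [Matrix.smul_mulVec, dotProduct_smul, Complex.smul_re, Complex.re_sum, smul_eq_mul]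
  exact key

lemma trace_mul_re_le_specNorm {S B : Matrix (Fin d) (Fin d) ℂ} (hS : S.IsHermitian)
    (hB : B.PosSemidef) : (S * B).trace.re ≤ specNorm S * B.trace.re := by
  have h : S ≤ ‖S‖ • 1 := by
    have := IsSelfAdjoint.le_algebraMap_norm_self (a := S) hS
    rwa [Algebra.algebraMap_eq_smul_one] at this
  have := trace_mul_re_mono h hB
  rwa [Matrix.smul_mul, Matrix.one_mul, Matrix.trace_smul, Complex.smul_re] at this

end SquareBounds

/-! ### Row and column sums against induced norms. -/

section InducedNorms

variable {n : ℕ} (D : Matrix (Fin n) (Fin n) ℝ)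

lemma inducedNorm_nonneg (p : ℝ≥0∞) [Fact (1 ≤ p)] : 0 ≤ inducedNorm p D := norm_nonneg _

/-- Test vector: the j-th basis vector, which D maps to its j-th column. -/
lemma sum_abs_col_le_inducedNorm_one (j : Fin n) : ∑ i, |D i j| ≤ inducedNorm 1 D := by
  have h := ContinuousLinearMap.le_opNorm
    (LinearMap.toContinuousLinearMap (Matrix.toLpLin 1 1 D)) (WithLp.toLp 1 (Pi.single j 1))
  simpa [PiLp.norm_eq_of_L1, inducedNorm, Matrix.toLpLin_apply, Pi.single_apply,
    apply_ite norm] using h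

/-- Test vector: the signs of row i. Its norm is only bounded by 1, because the row may vanish. -/
lemma sum_abs_row_le_inducedNorm_top (i : Fin n) : ∑ j, |D i j| ≤ inducedNorm ∞ D := by
  have h := ContinuousLinearMap.le_opNorm
    (LinearMap.toContinuousLinearMap (Matrix.toLpLin ∞ ∞ D))
    (WithLp.toLp ∞ fun j => (SignType.sign (D i j) : ℝ))
  have h1 : ‖(WithLp.toLp ∞ fun j => (SignType.sign (D i j) : ℝ) : PiLp ∞ fun _ : Fin n => ℝ)‖
      ≤ 1 := by
    rw [PiLp.norm_toLp, pi_norm_le_iff_of_nonneg zero_le_one]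
    intro j
    rcases lt_trichotomy (D i j) 0 with h | h | h <;> simp [h]
  have h2 : ∑ j, |D i j| ≤ ‖Matrix.toLpLin ∞ ∞ D
      (WithLp.toLp ∞ fun j => (SignType.sign (D i j) : ℝ))‖ := by
    rw [Matrix.toLpLin_apply, PiLp.norm_toLp]
    refine le_trans (le_of_eq ?_) (norm_le_pi_norm _ i)
    have : (D *ᵥ fun j => (SignType.sign (D i j) : ℝ)) i = ∑ j, |D i j| := by
      simp [Matrix.mulVec, dotProduct, self_mul_sign]
    simp only [this]
    rw [Real.norm_of_nonneg (Finset.sum_nonneg fun _ _ => abs_nonneg _)]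
  calc _ ≤ _ := h2
    _ ≤ _ := h
    _ ≤ inducedNorm ∞ D * 1 := mul_le_mul_of_nonneg_left h1 (norm_nonneg _)
    _ = _ := mul_one _

end InducedNorms

/-! ### Closure properties of bounded measurable functions. -/

section BoundedMeasurable

variable {α β F G : Type*} [MeasurableSpace α] [MeasurableSpace β]
  [NormedAddCommGroup F] [NormedAddCommGroup G]

/-- Bounded strongly measurable functions. -/
def IsBddMeas (g : α → F) : Prop := StronglyMeasurable g ∧ ∃ K : ℝ, ∀ x, ‖g x‖ ≤ K

lemma IsBddMeas.integrable {g : α → F} (hg : IsBddMeas g) (μ : Measure α) [IsFiniteMeasure μ] :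
    Integrable g μ :=
  let ⟨K, hK⟩ := hg.2
  Integrable.of_bound hg.1.aestronglyMeasurable K (ae_of_all _ hK)

lemma IsBddMeas.comp {g : α → F} (hg : IsBddMeas g) {f : β → α} (hf : Measurable f) :
    IsBddMeas fun x => g (f x) :=
  ⟨hg.1.comp_measurable hf, hg.2.imp fun _ hK x => hK (f x)⟩

lemma IsBddMeas.add {f g : α → F} (hf : IsBddMeas f) (hg : IsBddMeas g) :
    IsBddMeas fun x => f x + g x := by
  obtain ⟨K, hK⟩ := hf.2
  obtain ⟨K', hK'⟩ := hg.2
  exact ⟨hf.1.add hg.1, K + K', fun x => (norm_add_le _ _).trans (add_le_add (hK x) (hK' x))⟩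

lemma IsBddMeas.sub {f g : α → F} (hf : IsBddMeas f) (hg : IsBddMeas g) :
    IsBddMeas fun x => f x - g x := by
  obtain ⟨K, hK⟩ := hf.2
  obtain ⟨K', hK'⟩ := hg.2
  exact ⟨hf.1.sub hg.1, K + K', fun x => (norm_sub_le _ _).trans (add_le_add (hK x) (hK' x))⟩

lemma isBddMeas_const (c : F) : IsBddMeas fun _ : α => c :=
  ⟨stronglyMeasurable_const, ‖c‖, fun _ => le_rfl⟩

lemma IsBddMeas.sum {ι : Type*} (s : Finset ι) {f : ι → α → F} (hf : ∀ i, IsBddMeas (f i)) :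
    IsBddMeas fun x => ∑ i ∈ s, f i x := by
  classical
  induction s using Finset.induction_on with
  | empty => simpa using isBddMeas_const (0 : F)
  | insert i s hi ih =>
    simp only [Finset.sum_insert hi]
    exact (hf i).add ih

variable [NormedSpace ℝ F] [NormedSpace ℝ G]

lemma IsBddMeas.clm {g : α → F} (hg : IsBddMeas g) (L : F →L[ℝ] G) :
    IsBddMeas fun x => L (g x) := by
  obtain ⟨K, hK⟩ := hg.2
  exact ⟨L.continuous.comp_stronglyMeasurable hg.1, ‖L‖ * K, fun x => (L.le_opNorm _).trans
    (mul_le_mul_of_nonneg_left (hK x) (norm_nonneg _))⟩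

lemma IsBddMeas.const_smul {g : α → F} (hg : IsBddMeas g) (c : ℝ) : IsBddMeas fun x => c • g x :=
  hg.clm (c • ContinuousLinearMap.id ℝ F)

lemma IsBddMeas.integral_kernel {g : α × β → F} (hg : IsBddMeas g) (κ : Kernel α β)
    [IsMarkovKernel κ] : IsBddMeas fun x => ∫ y, g (x, y) ∂κ x := by
  obtain ⟨K, hK⟩ := hg.2
  refine ⟨hg.1.integral_kernel_prod_right', K, fun x => ?_⟩
  have := norm_integral_le_of_norm_le_const (μ := κ x) (ae_of_all _ fun y => hK (x, y))
  simpa using this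

end BoundedMeasurable

/-! ### Total variation and differences of integrals. -/

section TotalVariation

variable {α : Type*} [MeasurableSpace α] (μ ν : Measure α)
  [IsProbabilityMeasure μ] [IsProbabilityMeasure ν]

lemma abs_real_sub_le_tvDist {A : Set α} (hA : MeasurableSet A) :
    |μ.real A - ν.real A| ≤ tvDist μ ν := by
  refine le_ciSup (f := fun A : {A : Set α // MeasurableSet A} => |μ.real A - ν.real A|) ?_ ⟨A, hA⟩
  refine ⟨1, ?_⟩
  rintro _ ⟨B, rfl⟩
  have h1 := measureReal_le_one (μ := μ) (s := (B : Set α))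
  have h2 := measureReal_le_one (μ := ν) (s := (B : Set α))
  have h3 := measureReal_nonneg (μ := μ) (s := (B : Set α))
  have h4 := measureReal_nonneg (μ := ν) (s := (B : Set α))
  rw [abs_le]
  constructor <;> linarith

/-- The variational bound for the total variation distance. -/
lemma integral_sub_integral_le {f : α → ℝ} (hf : Measurable f) {C : ℝ}
    (hC : ∀ x y, f x - f y ≤ C) : ∫ x, f x ∂μ - ∫ x, f x ∂ν ≤ C * tvDist μ ν := by
  obtain ⟨x₀⟩ : Nonempty α := μ.nonempty_of_neZero
  have : Nonempty α := ⟨x₀⟩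
  have hC0 : 0 ≤ C := by simpa using hC x₀ x₀
  have hbdd : BddBelow (Set.range f) := ⟨f x₀ - C, by
    rintro _ ⟨x, rfl⟩
    linarith [hC x₀ x]⟩
  -- After subtraction of the infimum the values lie in [0, C]. The layer-cake integral then runs
  -- over an interval of length C, and each superlevel set costs at most one total variation
  -- distance.
  set m := ⨅ x, f x
  have h0 : ∀ x, 0 ≤ f x - m := fun x => sub_nonneg.2 (ciInf_le hbdd x)
  have h1 : ∀ x, f x - m ≤ C := fun x => by
    have : f x - C ≤ m := le_ciInf fun y => by linarith [hC x y]
    linarith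
  have hm : Measurable fun x => f x - m := hf.sub_const m
  have hint : ∀ (ρ : Measure α) [IsProbabilityMeasure ρ], Integrable (fun x => f x - m) ρ :=
    fun ρ _ => Integrable.of_bound hm.aestronglyMeasurable C (ae_of_all _ fun x => by
      rw [Real.norm_of_nonneg (h0 x)]; exact h1 x)
  have hval : ∀ (ρ : Measure α) [IsProbabilityMeasure ρ],
      ∫ x, f x ∂ρ = m + ∫ t in Set.Ioc 0 C, ρ.real {a | t ≤ f a - m} := by
    intro ρ _
    rw [← (hint ρ).integral_eq_integral_Ioc_meas_le (ae_of_all _ h0) (ae_of_all _ h1)]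
    have : ∫ x, f x ∂ρ = ∫ x, ((f x - m) + m) ∂ρ := by simp
    rw [this, integral_add (hint ρ) (integrable_const m)]
    simp [add_comm]
  have hintT : ∀ (ρ : Measure α) [IsProbabilityMeasure ρ],
      IntegrableOn (fun t => ρ.real {a | t ≤ f a - m}) (Set.Ioc 0 C) := by
    intro ρ _
    refine Measure.integrableOn_of_bounded (M := 1) (by simp) ?_ (ae_of_all _ fun t => ?_)
    · refine (Measurable.ennreal_toReal ?_).aestronglyMeasurable
      exact Antitone.measurable fun _ _ hst => measure_mono fun _ h => hst.trans h
    · rw [Real.norm_of_nonneg measureReal_nonneg]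
      exact measureReal_le_one
  rw [hval μ, hval ν, add_sub_add_left_eq_sub, ← integral_sub (hintT μ) (hintT ν)]
  calc _ ≤ ∫ _t in Set.Ioc 0 C, tvDist μ ν := by
        refine setIntegral_mono_on ((hintT μ).sub (hintT ν)) (integrable_const _)
          measurableSet_Ioc fun t _ => ?_
        exact (le_abs_self _).trans (abs_real_sub_le_tvDist μ ν (hm measurableSet_Ici))
    _ = C * tvDist μ ν := by simp [hC0]

/-- A functional of norm at most 1 that attains the norm of the difference reduces this to the
scalar bound with the same constant. -/
lemma norm_integral_sub_integral_le {F : Type*} [NormedAddCommGroup F] [NormedSpace ℝ F]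
    [CompleteSpace F] {f : α → F} (hf : IsBddMeas f) {C : ℝ} (hC : ∀ x y, ‖f x - f y‖ ≤ C) :
    ‖∫ x, f x ∂μ - ∫ x, f x ∂ν‖ ≤ C * tvDist μ ν := by
  obtain ⟨L, hL, hLv⟩ := exists_dual_vector'' ℝ (∫ x, f x ∂μ - ∫ x, f x ∂ν)
  have h := integral_sub_integral_le μ ν (hf.clm L).1.measurable (C := C) fun x y => by
    rw [← map_sub]
    calc L (f x - f y) ≤ ‖L (f x - f y)‖ := le_abs_self _
      _ ≤ ‖L‖ * ‖f x - f y‖ := L.le_opNorm _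
      _ ≤ 1 * ‖f x - f y‖ := mul_le_mul_of_nonneg_right hL (norm_nonneg _)
      _ ≤ C := by rw [one_mul]; exact hC x y
  rw [L.integral_comp_comm (hf.integrable μ), L.integral_comp_comm (hf.integrable ν),
    ← map_sub, hLv] at h
  exact h

end TotalVariation

/-! ### The Gibbs sampler and the propagation of oscillations. -/

section GibbsSampler

variable {n : ℕ} {E : Fin n → Type*} {F G : Type*} [NormedAddCommGroup F] [NormedAddCommGroup G]

lemma deleteCoord_update (j : Fin n) (z : ∀ k, E k) (w : E j) :
    deleteCoord j (Function.update z j w) = deleteCoord j z := by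
  ext k
  exact Function.update_of_ne k.2 _ _

/-- Coordinatewise oscillation bounds. -/
def HasOscLE (g : (∀ k, E k) → F) (a : Fin n → ℝ) : Prop :=
  ∀ j z (w : E j), ‖g z - g (Function.update z j w)‖ ≤ a j

/-- Coordinates are changed one at a time, by induction on the set where z and z' may differ. -/
lemma HasOscLE.norm_sub_le {g : (∀ k, E k) → F} {a : Fin n → ℝ} (hg : HasOscLE g a)
    (z z' : ∀ k, E k) : ‖g z - g z'‖ ≤ ∑ j, a j := by
  have key : ∀ (s : Finset (Fin n)) (z z' : ∀ k, E k), (∀ k ∉ s, z k = z' k) →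
      ‖g z - g z'‖ ≤ ∑ j ∈ s, a j := by
    intro s
    induction s using Finset.induction_on with
    | empty =>
      intro z z' h
      have : z = z' := funext fun k => h k (Finset.notMem_empty k)
      simp [this]
    | insert i s hi ih =>
      intro z z' h
      have h1 := hg i z (z' i)
      have h2 := ih (Function.update z i (z' i)) z' fun k hk => by
        by_cases hki : k = i
        · subst hki; simp
        · rw [Function.update_of_ne hki]
          exact h k (by simp [hki, hk])
      rw [Finset.sum_insert hi]
      exact (norm_sub_le_norm_sub_add_norm_sub _ _ _).trans (add_le_add h1 h2)
  exact key Finset.univ z z' (by simp)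

variable [∀ k, MeasurableSpace (E k)]

lemma IsBddMeas.update {g : (∀ k, E k) → F} (hg : IsBddMeas g) (j : Fin n) (z : ∀ k, E k) :
    IsBddMeas fun w => g (Function.update z j w) :=
  hg.comp (measurable_update z)

variable [NormedSpace ℝ F] [NormedSpace ℝ G]

lemma measurable_deleteCoord (j : Fin n) : Measurable (deleteCoord (E := E) j) :=
  measurable_pi_lambda _ fun _ => measurable_pi_apply _

/-- Resampling of the `j`-th coordinate from the kernel `κ j`. -/
noncomputable def gibbsAt (κ : ∀ i : Fin n, Kernel (∀ k : {k : Fin n // k ≠ i}, E k) (E i))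
    (j : Fin n) (g : (∀ k, E k) → F) (z : ∀ k, E k) : F :=
  ∫ w, g (Function.update z j w) ∂κ j (deleteCoord j z)

/-- The transition operator of the Gibbs sampler, which resamples a coordinate chosen uniformly
at random. -/
noncomputable def gibbs (κ : ∀ i : Fin n, Kernel (∀ k : {k : Fin n // k ≠ i}, E k) (E i))
    (g : (∀ k, E k) → F) (z : ∀ k, E k) : F :=
  (n : ℝ)⁻¹ • ∑ j, gibbsAt κ j g z

variable (κ : ∀ i : Fin n, Kernel (∀ k : {k : Fin n // k ≠ i}, E k) (E i))
  [∀ i, IsMarkovKernel (κ i)]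

lemma isBddMeas_integral_update {g : (∀ k, E k) → (∀ k, E k) → F}
    (hg : IsBddMeas (Function.uncurry g)) (j : Fin n) :
    IsBddMeas fun z => ∫ w, g z (Function.update z j w) ∂κ j (deleteCoord j z) :=
  (hg.comp (f := fun p : (∀ k, E k) × E j => (p.1, Function.update p.1 j p.2))
    (measurable_fst.prodMk measurable_update')).integral_kernel
    ((κ j).comap (deleteCoord j) (measurable_deleteCoord j))

lemma IsBddMeas.gibbsAt {g : (∀ k, E k) → F} (hg : IsBddMeas g) (j : Fin n) :
    IsBddMeas (gibbsAt κ j g) :=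
  isBddMeas_integral_update κ (g := fun _ z' => g z') (hg.comp measurable_snd) j

lemma IsBddMeas.gibbs {g : (∀ k, E k) → F} (hg : IsBddMeas g) : IsBddMeas (gibbs κ g) :=
  (IsBddMeas.sum _ fun j => hg.gibbsAt κ j).const_smul _

lemma IsBddMeas.iterate_gibbs {g : (∀ k, E k) → F} (hg : IsBddMeas g) (m : ℕ) :
    IsBddMeas ((_root_.gibbs κ)^[m] g) := by
  induction m with
  | zero => exact hg
  | succ m ih => rw [Function.iterate_succ_apply']; exact ih.gibbs κ

lemma gibbsAt_clm [CompleteSpace F] [CompleteSpace G] {g : (∀ k, E k) → F} (hg : IsBddMeas g)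
    (L : F →L[ℝ] G) (j : Fin n) (z : ∀ k, E k) :
    gibbsAt κ j (fun x => L (g x)) z = L (gibbsAt κ j g z) :=
  L.integral_comp_comm ((hg.update j z).integrable _)

lemma gibbs_clm [CompleteSpace F] [CompleteSpace G] {g : (∀ k, E k) → F} (hg : IsBddMeas g)
    (L : F →L[ℝ] G) : gibbs κ (fun x => L (g x)) = fun z => L (gibbs κ g z) := by
  ext z
  simp only [gibbs, gibbsAt_clm κ hg L, map_smul, map_sum]

/-- Applied to conjugate transposition it shows that iterates stay Hermitian; applied to evaluation
at a vector it reduces squares of matrices to vector norms. -/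
lemma iterate_gibbs_clm [CompleteSpace F] [CompleteSpace G] {g : (∀ k, E k) → F}
    (hg : IsBddMeas g) (L : F →L[ℝ] G) (m : ℕ) :
    (gibbs κ)^[m] (fun x => L (g x)) = fun z => L ((gibbs κ)^[m] g z) := by
  induction m with
  | zero => rfl
  | succ m ih =>
    rw [Function.iterate_succ_apply', ih, gibbs_clm κ (hg.iterate_gibbs κ m) L]
    simp only [Function.iterate_succ_apply']

/-- The matrix that governs the decay of the coordinatewise oscillations under the Gibbs
sampler. -/
noncomputable def gibbsMatrix (D : Matrix (Fin n) (Fin n) ℝ) : Matrix (Fin n) (Fin n) ℝ :=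
  (1 - (n : ℝ)⁻¹) • 1 + (n : ℝ)⁻¹ • Matrix.of fun j k => |D k j|

variable {κ} {D : Matrix (Fin n) (Fin n) ℝ}

/-- For i = j resampling erases the changed coordinate. Otherwise changing z_j has two effects: on
the integrand, at cost a_j, and on the resampling law, whose total variation moves by at most |D_ij|
and is paid for by the oscillation a_i of the integrand. -/
lemma HasOscLE.gibbsAt [CompleteSpace F]
    (hD : ∀ (i : Fin n) (x y : ∀ k, E k),
      tvDist (κ i (deleteCoord i x)) (κ i (deleteCoord i y)) ≤
        ∑ j, D i j * ({j | x j ≠ y j} : Set (Fin n)).indicator 1 j)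
    {g : (∀ k, E k) → F} (hg : IsBddMeas g) {a : Fin n → ℝ} (ha : HasOscLE g a) (i : Fin n) :
    HasOscLE (gibbsAt κ i g) fun j => (if i = j then 0 else a j) + |D i j| * a i := by
  intro j z w
  have ha0 : 0 ≤ a i := (norm_nonneg _).trans (ha i z (z i))
  beta_reduce
  by_cases hij : i = j
  · subst hij
    have : _root_.gibbsAt κ i g (Function.update z i w) = _root_.gibbsAt κ i g z := by
      simp only [_root_.gibbsAt, deleteCoord_update, Function.update_idem]
    rw [this, sub_self, norm_zero, if_pos rfl, zero_add]
    positivity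
  · rw [if_neg hij]
    set z' := Function.update z j w with hz'
    have hI : ∀ (x y : ∀ k, E k),
        Integrable (fun v => g (Function.update x i v)) (κ i (deleteCoord i y)) :=
      fun x y => (hg.update i x).integrable _
    have htv : tvDist (κ i (deleteCoord i z)) (κ i (deleteCoord i z')) ≤ |D i j| := by
      refine (hD i z z').trans ?_
      rw [Finset.sum_eq_single j]
      · by_cases h : z j ≠ z' j
        · simp [h, le_abs_self]
        · simp [h]
      · intro k _ hk
        simp [hz', Function.update_of_ne hk]
      · simp
    have h1 : ‖∫ v, g (Function.update z i v) ∂κ i (deleteCoord i z) -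
        ∫ v, g (Function.update z' i v) ∂κ i (deleteCoord i z)‖ ≤ a j := by
      rw [← integral_sub (hI z z) (hI z' z)]
      refine (norm_integral_le_of_norm_le_const (C := a j) (ae_of_all _ fun v => ?_)).trans
        (by simp)
      rw [hz', Function.update_comm (Ne.symm hij)]
      exact ha j _ w
    have h2 : ‖∫ v, g (Function.update z' i v) ∂κ i (deleteCoord i z) -
        ∫ v, g (Function.update z' i v) ∂κ i (deleteCoord i z')‖ ≤ |D i j| * a i := by
      refine (norm_integral_sub_integral_le _ _ (hg.update i z') (C := a i) fun x y => ?_).trans ?_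
      · have := ha i (Function.update z' i x) y
        rwa [Function.update_idem] at this
      · rw [mul_comm]
        exact mul_le_mul_of_nonneg_right htv ha0
    exact (norm_sub_le_norm_sub_add_norm_sub _ _ _).trans (add_le_add h1 h2)

/-- All but one of the n possible updates keep the old oscillation a_j, which gives the factor 1 -
1/n. The influence of j on i enters through D_ij, so `gibbsMatrix D` contains the transpose of |D|.
-/
lemma HasOscLE.gibbs [CompleteSpace F]
    (hD : ∀ (i : Fin n) (x y : ∀ k, E k),
      tvDist (κ i (deleteCoord i x)) (κ i (deleteCoord i y)) ≤
        ∑ j, D i j * ({j | x j ≠ y j} : Set (Fin n)).indicator 1 j)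
    {g : (∀ k, E k) → F} (hg : IsBddMeas g) {a : Fin n → ℝ} (ha : HasOscLE g a) :
    HasOscLE (gibbs κ g) (gibbsMatrix D *ᵥ a) := by
  intro j z w
  have hn : (n : ℝ) ≠ 0 := Nat.cast_ne_zero.2 (Fin.pos j).ne'
  have hval : (gibbsMatrix D *ᵥ a) j =
      (n : ℝ)⁻¹ * ∑ i, ((if i = j then 0 else a j) + |D i j| * a i) := by
    have h1 : ∑ i : Fin n, (if i = j then 0 else a j) = (n - 1) * a j := by
      have : ∀ i : Fin n, (if i = j then 0 else a j) = a j - if i = j then a j else 0 := by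
        intro i; split_ifs <;> simp
      simp only [this, Finset.sum_sub_distrib]
      simp [sub_mul]
    rw [Finset.sum_add_distrib, h1, gibbsMatrix, Matrix.add_mulVec, Matrix.smul_mulVec,
      Matrix.smul_mulVec, Matrix.one_mulVec]
    simp only [Pi.add_apply, Pi.smul_apply, smul_eq_mul, Matrix.mulVec, dotProduct,
      Matrix.of_apply]
    field_simp
  rw [hval]
  simp only [_root_.gibbs]
  rw [← smul_sub, ← Finset.sum_sub_distrib, norm_smul, Real.norm_of_nonneg (by positivity)]
  refine mul_le_mul_of_nonneg_left ?_ (by positivity)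
  exact (norm_sum_le _ _).trans (Finset.sum_le_sum fun i _ => ha.gibbsAt hD hg i j z w)

lemma HasOscLE.iterate_gibbs [CompleteSpace F]
    (hD : ∀ (i : Fin n) (x y : ∀ k, E k),
      tvDist (κ i (deleteCoord i x)) (κ i (deleteCoord i y)) ≤
        ∑ j, D i j * ({j | x j ≠ y j} : Set (Fin n)).indicator 1 j)
    {g : (∀ k, E k) → F} (hg : IsBddMeas g) {a : Fin n → ℝ} (ha : HasOscLE g a) (m : ℕ) :
    HasOscLE ((_root_.gibbs κ)^[m] g) (gibbsMatrix D ^ m *ᵥ a) := by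
  induction m with
  | zero => simpa using ha
  | succ m ih =>
    rw [Function.iterate_succ_apply', pow_succ', ← Matrix.mulVec_mulVec]
    exact ih.gibbs hD (hg.iterate_gibbs κ m)

end GibbsSampler

/-! ### Row and column sums of powers of the Gibbs matrix. -/

section GibbsMatrix

variable {n : ℕ} (D : Matrix (Fin n) (Fin n) ℝ)

lemma gibbsMatrix_nonneg (j k : Fin n) : 0 ≤ gibbsMatrix D j k := by
  have hn : (1 : ℝ) ≤ n := Nat.one_le_cast.2 (Fin.pos j)
  have h1 : 0 ≤ 1 - (n : ℝ)⁻¹ := sub_nonneg.2 (inv_le_one_of_one_le₀ hn)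
  simp only [gibbsMatrix, Matrix.add_apply, Matrix.smul_apply, Matrix.one_apply, Matrix.of_apply,
    smul_eq_mul]
  have : (0 : ℝ) ≤ if j = k then 1 else 0 := by split_ifs <;> norm_num
  positivity

lemma gibbsMatrix_pow_nonneg (m : ℕ) (j k : Fin n) : 0 ≤ (gibbsMatrix D ^ m) j k := by
  induction m generalizing j k with
  | zero =>
    rw [pow_zero, Matrix.one_apply]
    split_ifs <;> norm_num
  | succ m ih =>
    rw [pow_succ, Matrix.mul_apply]
    exact Finset.sum_nonneg fun i _ => mul_nonneg (ih j i) (gibbsMatrix_nonneg D i k)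

/-- Because of the transposition, row j involves column j of D, hence the ℓ₁ norm. -/
lemma sum_row_gibbsMatrix_le (j : Fin n) :
    ∑ k, gibbsMatrix D j k ≤ 1 - (1 - inducedNorm 1 D) / n := by
  have h := mul_le_mul_of_nonneg_left (sum_abs_col_le_inducedNorm_one D j)
    (inv_nonneg.2 (Nat.cast_nonneg (α := ℝ) n))
  simp only [gibbsMatrix, Matrix.add_apply, Matrix.smul_apply, Matrix.one_apply, Matrix.of_apply,
    smul_eq_mul, Finset.sum_add_distrib, ← Finset.mul_sum, Finset.sum_ite_eq, Finset.mem_univ,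
    if_true]
  rw [div_eq_inv_mul]
  linarith

lemma sum_col_gibbsMatrix_le (k : Fin n) :
    ∑ j, gibbsMatrix D j k ≤ 1 - (1 - inducedNorm ∞ D) / n := by
  have h := mul_le_mul_of_nonneg_left (sum_abs_row_le_inducedNorm_top D k)
    (inv_nonneg.2 (Nat.cast_nonneg (α := ℝ) n))
  simp only [gibbsMatrix, Matrix.add_apply, Matrix.smul_apply, Matrix.one_apply, Matrix.of_apply,
    smul_eq_mul, Finset.sum_add_distrib, ← Finset.mul_sum, Finset.sum_ite_eq', Finset.mem_univ,
    if_true]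
  rw [div_eq_inv_mul]
  linarith

lemma sum_row_gibbsMatrix_pow_le {r : ℝ} (hr : ∀ j, ∑ k, gibbsMatrix D j k ≤ r) (hr0 : 0 ≤ r)
    (m : ℕ) (j : Fin n) : ∑ k, (gibbsMatrix D ^ m) j k ≤ r ^ m := by
  induction m with
  | zero => simp [Matrix.one_apply]
  | succ m ih =>
    simp only [pow_succ, Matrix.mul_apply]
    rw [Finset.sum_comm]
    simp only [← Finset.mul_sum]
    calc _ ≤ ∑ i, (gibbsMatrix D ^ m) j i * r := Finset.sum_le_sum fun i _ =>
          mul_le_mul_of_nonneg_left (hr i) (gibbsMatrix_pow_nonneg D m j i)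
      _ ≤ _ := by
        rw [← Finset.sum_mul]
        exact mul_le_mul_of_nonneg_right ih hr0

lemma sum_col_gibbsMatrix_pow_le {r : ℝ} (hr : ∀ k, ∑ j, gibbsMatrix D j k ≤ r) (hr0 : 0 ≤ r)
    (m : ℕ) (k : Fin n) : ∑ j, (gibbsMatrix D ^ m) j k ≤ r ^ m := by
  induction m generalizing k with
  | zero => simp [Matrix.one_apply]
  | succ m ih =>
    simp only [pow_succ, Matrix.mul_apply]
    rw [Finset.sum_comm]
    simp only [← Finset.sum_mul]
    calc _ ≤ ∑ i, r ^ m * gibbsMatrix D i k := Finset.sum_le_sum fun i _ =>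
          mul_le_mul_of_nonneg_right (ih i) (gibbsMatrix_nonneg D i k)
      _ ≤ _ := by
        rw [← Finset.mul_sum]
        exact mul_le_mul_of_nonneg_left (hr k) (pow_nonneg hr0 m)

end GibbsMatrix

/-! ### Exchangeability under resampling and stationarity. -/

section Reversibility

variable {n : ℕ} {E : Fin n → Type*} {F : Type*} [NormedAddCommGroup F]

/-- The vector with `j`-th coordinate `w` and the other coordinates given by `y`. -/
def insertCoord (z₀ : ∀ k, E k) (j : Fin n) (y : ∀ k : {k : Fin n // k ≠ j}, E k) (w : E j) :
    ∀ k, E k :=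
  Function.update (fun k => if h : k ≠ j then y ⟨k, h⟩ else z₀ k) j w

lemma insertCoord_deleteCoord (z₀ z : ∀ k, E k) (j : Fin n) :
    insertCoord z₀ j (deleteCoord j z) (z j) = z := by
  ext k
  by_cases h : k = j
  · subst h; simp [insertCoord]
  · simp [insertCoord, deleteCoord, h]

lemma update_insertCoord (z₀ : ∀ k, E k) (j : Fin n) (y : ∀ k : {k : Fin n // k ≠ j}, E k)
    (w w' : E j) : Function.update (insertCoord z₀ j y w) j w' = insertCoord z₀ j y w' :=
  Function.update_idem _ _ _

lemma deleteCoord_insertCoord (z₀ : ∀ k, E k) (j : Fin n) (y : ∀ k : {k : Fin n // k ≠ j}, E k)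
    (w : E j) : deleteCoord j (insertCoord z₀ j y w) = y := by
  ext k
  simp [insertCoord, deleteCoord, k.2]

variable [∀ k, MeasurableSpace (E k)] [NormedSpace ℝ F]

lemma measurable_insertCoord (z₀ : ∀ k, E k) (j : Fin n) :
    Measurable fun p : (∀ k : {k : Fin n // k ≠ j}, E k) × E j => insertCoord z₀ j p.1 p.2 := by
  refine measurable_update'.comp (Measurable.prodMk ?_ measurable_snd)
  refine measurable_pi_lambda _ fun k => ?_
  by_cases h : k ≠ j
  · convert! (measurable_pi_apply (⟨k, h⟩ : {k : Fin n // k ≠ j})).comp measurable_fst using 1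
    exact funext fun p => dif_pos h
  · convert! measurable_const (a := z₀ k) using 1
    exact funext fun p => dif_neg h

variable {κ : ∀ i : Fin n, Kernel (∀ k : {k : Fin n // k ≠ i}, E k) (E i)}
  [∀ i, IsMarkovKernel (κ i)] {π : Measure (∀ k, E k)} [IsProbabilityMeasure π]

/-- Exchangeability of a random vector and its modification by resampling one coordinate from its
conditional distribution. -/
theorem integral_resample_comm {j : Fin n}
    (hπ : π.map (fun z => (deleteCoord j z, z j)) = (π.map (deleteCoord j)) ⊗ₘ κ j)
    {f : (∀ k, E k) → (∀ k, E k) → F} (hf : IsBddMeas (Function.uncurry f)) :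
    ∫ z, ∫ w, f z (Function.update z j w) ∂κ j (deleteCoord j z) ∂π =
      ∫ z, ∫ w, f (Function.update z j w) z ∂κ j (deleteCoord j z) ∂π := by
  -- The choice of base point is immaterial: `insertCoord` reads it only at coordinate j, which is
  -- then overwritten.
  obtain ⟨z₀⟩ : Nonempty (∀ k, E k) := π.nonempty_of_neZero
  have hdel := measurable_deleteCoord (E := E) j
  have : IsProbabilityMeasure (π.map (deleteCoord j)) :=
    Measure.isProbabilityMeasure_map hdel.aemeasurable
  have hpair : Measurable fun z : ∀ k, E k => (deleteCoord j z, z j) :=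
    hdel.prodMk (measurable_pi_apply j)
  have hins := measurable_insertCoord z₀ j
  -- Given y = z_{-j}, the old and the resampled j-th coordinates are independent with the same law
  -- κ j y. In this form the exchange of the two states is Fubini's theorem.
  have disint : ∀ g : (∀ k, E k) → (∀ k, E k) → F, IsBddMeas (Function.uncurry g) →
      ∫ z, ∫ w, g z (Function.update z j w) ∂κ j (deleteCoord j z) ∂π =
        ∫ y, ∫ w, ∫ w', g (insertCoord z₀ j y w) (insertCoord z₀ j y w') ∂κ j y ∂κ j y
          ∂(π.map (deleteCoord j)) := by
    intro g hg
    have hG := isBddMeas_integral_update κ hg j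
    set G := fun z => ∫ w, g z (Function.update z j w) ∂κ j (deleteCoord j z) with hGdef
    have hG' := hG.comp hins
    calc ∫ z, G z ∂π = ∫ z, G (insertCoord z₀ j (deleteCoord j z) (z j)) ∂π := by
          simp only [insertCoord_deleteCoord]
      _ = ∫ p, G (insertCoord z₀ j p.1 p.2) ∂(π.map fun z => (deleteCoord j z, z j)) :=
          (integral_map_of_stronglyMeasurable hpair hG'.1).symm
      _ = ∫ y, ∫ w, G (insertCoord z₀ j y w) ∂κ j y ∂(π.map (deleteCoord j)) := by
          rw [hπ, Measure.integral_compProd (hG'.integrable _)]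
      _ = _ := by
          simp only [hGdef, deleteCoord_insertCoord, update_insertCoord]
  rw [disint f hf, disint (fun z z' => f z' z) (hf.comp measurable_swap)]
  refine integral_congr_ae (ae_of_all _ fun y => ?_)
  refine integral_integral_swap (IsBddMeas.integrable ?_ _)
  exact hf.comp (f := fun p : E j × E j => (insertCoord z₀ j y p.1, insertCoord z₀ j y p.2))
    ((hins.comp (measurable_prodMk_left.comp measurable_fst)).prodMk
      (hins.comp (measurable_prodMk_left.comp measurable_snd)))

/-- This is exchangeability for a function of the new state alone: after the exchange the integrand
no longer depends on w. -/
lemma integral_gibbsAt {j : Fin n}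
    (hπ : π.map (fun z => (deleteCoord j z, z j)) = (π.map (deleteCoord j)) ⊗ₘ κ j)
    [CompleteSpace F] {g : (∀ k, E k) → F} (hg : IsBddMeas g) :
    ∫ z, gibbsAt κ j g z ∂π = ∫ z, g z ∂π := by
  have := integral_resample_comm hπ (f := fun _ z' => g z') (hg.comp measurable_snd)
  simpa [gibbsAt] using this

/-- Each `gibbsAt` preserves the integral, hence so does their average. For n = 0 the average is
empty and `gibbs` is zero. -/
lemma integral_iterate_gibbs (hn : n ≠ 0)
    (hπ : ∀ j, π.map (fun z => (deleteCoord j z, z j)) = (π.map (deleteCoord j)) ⊗ₘ κ j)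
    [CompleteSpace F] {g : (∀ k, E k) → F} (hg : IsBddMeas g) (m : ℕ) :
    ∫ z, (gibbs κ)^[m] g z ∂π = ∫ z, g z ∂π := by
  induction m with
  | zero => rfl
  | succ m ih =>
    simp only [Function.iterate_succ_apply']
    have hm := hg.iterate_gibbs κ m
    set g' := (gibbs κ)^[m] g
    simp only [gibbs]
    rw [integral_smul, integral_finsetSum _ fun j _ => (hm.gibbsAt κ j).integrable π]
    simp only [integral_gibbsAt (hπ _) hm, ih]
    simp only [Finset.sum_const, Finset.card_univ, Fintype.card_fin]
    rw [← Nat.cast_smul_eq_nsmul ℝ, smul_smul, inv_mul_cancel₀ (Nat.cast_ne_zero.2 hn), one_smul]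

end Reversibility

/-! ### Linear maps and exponentials of matrix-valued functions. -/

section MatrixValued

open scoped Matrix.Norms.L2Operator

variable {d : ℕ} {α : Type*} [MeasurableSpace α]

/-- The real part of the trace as a continuous linear form. -/
noncomputable def traceRe : Matrix (Fin d) (Fin d) ℂ →L[ℝ] ℝ :=
  LinearMap.toContinuousLinearMap (Complex.reLm ∘ₗ Matrix.traceLinearMap (Fin d) ℝ ℂ)

/-- Conjugate transposition as a continuous real-linear map. -/
noncomputable def conjTransposeCLM :
    Matrix (Fin d) (Fin d) ℂ →L[ℝ] Matrix (Fin d) (Fin d) ℂ :=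
  LinearMap.toContinuousLinearMap (Matrix.conjTransposeLinearEquiv (Fin d) (Fin d) ℝ ℂ).toLinearMap

/-- Application of a matrix to a fixed vector as a continuous real-linear map. -/
noncomputable def applyVec (u : EuclideanSpace ℂ (Fin d)) :
    Matrix (Fin d) (Fin d) ℂ →L[ℝ] EuclideanSpace ℂ (Fin d) :=
  LinearMap.toContinuousLinearMap
    { toFun := fun M => Matrix.toEuclideanCLM (𝕜 := ℂ) M u
      map_add' := fun M N => by rw [map_add]; rfl
      map_smul' := fun c M => by
        ext i
        simp [Matrix.smul_mulVec] }

lemma continuous_matrix_exp :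
    Continuous (NormedSpace.exp : Matrix (Fin d) (Fin d) ℂ → Matrix (Fin d) (Fin d) ℂ) := by
  let : NormedAlgebra ℚ (Matrix (Fin d) (Fin d) ℂ) := NormedAlgebra.restrictScalars ℚ ℂ _
  exact NormedSpace.exp_continuous

lemma IsBddMeas.matrix_exp {h : α → Matrix (Fin d) (Fin d) ℂ} (hh : IsBddMeas h) :
    IsBddMeas fun x => NormedSpace.exp (h x) := by
  refine ⟨continuous_matrix_exp.comp_stronglyMeasurable hh.1, ?_⟩
  obtain ⟨K, hK⟩ := hh.2
  obtain ⟨C, hC⟩ := (isCompact_closedBall (0 : Matrix (Fin d) (Fin d) ℂ) K).exists_bound_of_continuousOn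
    continuous_matrix_exp.continuousOn
  exact ⟨C, fun x => hC _ (mem_closedBall_zero_iff.2 (hK x))⟩

lemma IsBddMeas.matrix_mul {f g : α → Matrix (Fin d) (Fin d) ℂ} (hf : IsBddMeas f)
    (hg : IsBddMeas g) : IsBddMeas fun x => f x * g x := by
  obtain ⟨K, hK⟩ := hf.2
  obtain ⟨K', hK'⟩ := hg.2
  refine ⟨hf.1.mul hg.1, K * K', fun x => (norm_mul_le _ _).trans ?_⟩
  exact mul_le_mul (hK x) (hK' x) (norm_nonneg _) ((norm_nonneg _).trans (hK x))

end MatrixValued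

/-! ### The exchangeable pair estimate for one coordinate. -/

section SteinMethod

open scoped Matrix.Norms.L2Operator

variable {n d : ℕ} {E : Fin n → Type*} {D : Matrix (Fin n) (Fin n) ℝ}
  {h : (∀ k, E k) → Matrix (Fin d) (Fin d) ℂ} {A : Fin n → Matrix (Fin d) (Fin d) ℂ}

lemma hasOscLE_of_sq_le (hherm : ∀ z, (h z).IsHermitian) (hA : ∀ j, (A j).IsHermitian)
    (hdiff : ∀ j z (w : E j), (h z - h (Function.update z j w)) ^ 2 ≤ A j ^ 2) :
    HasOscLE h fun j => ‖A j‖ := fun j z w =>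
  norm_le_of_sq_le ((hherm z).sub (hherm _)) (hA j) (hdiff j z w)

variable [∀ k, MeasurableSpace (E k)]
  {κ : ∀ i : Fin n, Kernel (∀ k : {k : Fin n // k ≠ i}, E k) (E i)} [∀ i, IsMarkovKernel (κ i)]
  {π : Measure (∀ k, E k)} [IsProbabilityMeasure π]

/-- For centred g, the value g z is the average of g z - g z' over z'. -/
lemma HasOscLE.norm_le_of_integral_eq_zero {F : Type*} [NormedAddCommGroup F] [NormedSpace ℝ F]
    [CompleteSpace F] {g : (∀ k, E k) → F} (hg : IsBddMeas g) {a : Fin n → ℝ} (ha : HasOscLE g a)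
    (h0 : ∫ z, g z ∂π = 0) (z : ∀ k, E k) : ‖g z‖ ≤ ∑ j, a j := by
  have h1 : g z = ∫ z', (g z - g z') ∂π := by
    rw [integral_sub (integrable_const _) (hg.integrable π), h0]
    simp
  rw [h1]
  refine (norm_integral_le_of_norm_le_const (ae_of_all _ fun z' => ha.norm_sub_le z z')).trans ?_
  simp

lemma isHermitian_iterate_gibbs (hh : IsBddMeas h) (hherm : ∀ z, (h z).IsHermitian) (m : ℕ)
    (z : ∀ k, E k) : ((gibbs κ)^[m] h z).IsHermitian := by
  have h1 := congrFun (iterate_gibbs_clm κ hh conjTransposeCLM m) z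
  have h2 : (fun z => conjTransposeCLM (h z)) = h := funext fun z => (hherm z).eq
  rw [h2] at h1
  exact h1.symm

/-- For each fixed u the oscillations of z ↦ h(z)u are at most ‖A_k u‖ and propagate through M^m.
Cauchy–Schwarz with the weights (M^m)_jk reassembles these bounds over all u into a matrix
inequality, which keeps the A_k² rather than only their norms. -/
lemma sq_iterate_gibbs_sub_le
    (hD : ∀ (i : Fin n) (x y : ∀ k, E k),
      tvDist (κ i (deleteCoord i x)) (κ i (deleteCoord i y)) ≤
        ∑ j, D i j * ({j | x j ≠ y j} : Set (Fin n)).indicator 1 j)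
    (hh : IsBddMeas h) (hherm : ∀ z, (h z).IsHermitian) (hA : ∀ j, (A j).IsHermitian)
    (hdiff : ∀ j z (w : E j), (h z - h (Function.update z j w)) ^ 2 ≤ A j ^ 2)
    (m : ℕ) (j : Fin n) (z : ∀ k, E k) (w : E j) :
    ((gibbs κ)^[m] h z - (gibbs κ)^[m] h (Function.update z j w)) ^ 2 ≤
      (∑ k, (gibbsMatrix D ^ m) j k) • ∑ k, (gibbsMatrix D ^ m) j k • A k ^ 2 := by
  refine sq_le_sum_smul_sq _ ((isHermitian_iterate_gibbs hh hherm m z).sub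
    (isHermitian_iterate_gibbs hh hherm m _)) hA (gibbsMatrix_pow_nonneg D m j) fun u => ?_
  have hu : HasOscLE (fun z => applyVec u (h z)) fun k => ‖applyVec u (A k)‖ := by
    intro k z w
    rw [← map_sub]
    exact norm_toEuclideanCLM_le_of_sq_le ((hherm z).sub (hherm _)) (hA k) (hdiff k z w) u
  have := hu.iterate_gibbs hD (hh.clm (applyVec u)) m j z w
  rw [iterate_gibbs_clm κ hh, ← map_sub] at this
  exact this

/-- Symmetrization over the exchangeable pair obtained by resampling one coordinate. -/
lemma integral_resample_le {j : Fin n}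
    (hπ : π.map (fun z => (deleteCoord j z, z j)) = (π.map (deleteCoord j)) ⊗ₘ κ j)
    {f : (∀ k, E k) → (∀ k, E k) → ℝ} (hf : IsBddMeas (Function.uncurry f))
    {e : (∀ k, E k) → ℝ} (he : IsBddMeas e)
    (hfe : ∀ z (w : E j), f z (Function.update z j w) + f (Function.update z j w) z ≤
      e z + e (Function.update z j w)) :
    ∫ z, ∫ w, f z (Function.update z j w) ∂κ j (deleteCoord j z) ∂π ≤ ∫ z, e z ∂π := by
  have hf' : IsBddMeas (Function.uncurry fun z z' => f z' z) := hf.comp measurable_swap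
  have he' : IsBddMeas (gibbsAt κ j e) := he.gibbsAt κ j
  have hslice : ∀ {f : (∀ k, E k) → (∀ k, E k) → ℝ}, IsBddMeas (Function.uncurry f) → ∀ z,
      Integrable (fun w => f z (Function.update z j w)) (κ j (deleteCoord j z)) := fun hf z =>
    (hf.comp (measurable_const.prodMk (measurable_update z))).integrable _
  have hout : ∀ {f : (∀ k, E k) → (∀ k, E k) → ℝ}, IsBddMeas (Function.uncurry f) →
      Integrable (fun z => ∫ w, f z (Function.update z j w) ∂κ j (deleteCoord j z)) π := fun hf =>
    (isBddMeas_integral_update κ hf j).integrable _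
  have hmain : ∫ z, ∫ w, f z (Function.update z j w) ∂κ j (deleteCoord j z) ∂π +
      ∫ z, ∫ w, f (Function.update z j w) z ∂κ j (deleteCoord j z) ∂π ≤
      ∫ z, e z ∂π + ∫ z, gibbsAt κ j e z ∂π := by
    rw [← integral_add (hout hf) (hout hf'), ← integral_add (he.integrable π) (he'.integrable π)]
    refine integral_mono ((hout hf).add (hout hf')) ((he.integrable π).add (he'.integrable π))
      fun z => ?_
    have hez : e z + gibbsAt κ j e z =
        ∫ w, (e z + e (Function.update z j w)) ∂κ j (deleteCoord j z) := by
      rw [integral_add (integrable_const _) ((he.update j z).integrable _)]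
      simp [gibbsAt]
    beta_reduce
    rw [hez, ← integral_add (hslice hf z) (hslice hf' z)]
    exact integral_mono ((hslice hf z).add (hslice hf' z))
      ((integrable_const _).add ((he.update j z).integrable _)) fun w => hfe z w
  -- By exchangeability the two integrals on the left coincide, and so do the two on the right; the
  -- factor 2 cancels.
  rw [← integral_resample_comm hπ hf, integral_gibbsAt hπ he] at hmain
  linarith

/-- One term of the exchangeable pair bound for matrices. -/
lemma integral_trace_sub_gibbsAt_mul_exp_le {j : Fin n}
    (hπ : π.map (fun z => (deleteCoord j z, z j)) = (π.map (deleteCoord j)) ⊗ₘ κ j)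
    (hh : IsBddMeas h) (hherm : ∀ z, (h z).IsHermitian)
    {g : (∀ k, E k) → Matrix (Fin d) (Fin d) ℂ} (hg : IsBddMeas g)
    (hgherm : ∀ z, (g z).IsHermitian) {B C : Matrix (Fin d) (Fin d) ℂ}
    (hB : ∀ z (w : E j), (h z - h (Function.update z j w)) ^ 2 ≤ B)
    (hC : ∀ z (w : E j), (g z - g (Function.update z j w)) ^ 2 ≤ C)
    {s θ : ℝ} (hs : 0 < s) :
    ∫ z, ((g z - gibbsAt κ j g z) * NormedSpace.exp (θ • h z)).trace.re ∂π ≤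
      ∫ z, 1 / 4 * (((s * θ ^ 2) • B + s⁻¹ • C) * NormedSpace.exp (θ • h z)).trace.re ∂π := by
  have hherm' : ∀ z, (θ • h z).IsHermitian := fun z => IsSelfAdjoint.smul (.all θ) (hherm z)
  obtain ⟨Φ, hΦ⟩ : ∃ Φ : (∀ k, E k) → Matrix (Fin d) (Fin d) ℂ,
    ∀ z, NormedSpace.exp (θ • h z) = Φ z := ⟨_, fun _ => rfl⟩
  obtain ⟨Q, hQ⟩ : ∃ Q : Matrix (Fin d) (Fin d) ℂ, (s * θ ^ 2) • B + s⁻¹ • C = Q := ⟨_, rfl⟩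
  have hΦb : IsBddMeas Φ := by
    simpa only [hΦ] using (hh.const_smul θ).matrix_exp
  have hpt : ∀ z (w : E j), ((g z - g (Function.update z j w)) *
      (Φ z - Φ (Function.update z j w))).trace.re ≤
        1 / 4 * (Q * (Φ z + Φ (Function.update z j w))).trace.re := by
    intro z w
    have h1 := trace_mul_exp_sub_exp_le (hherm' z) (hherm' (Function.update z j w))
      ((hgherm z).sub (hgherm (Function.update z j w))) hs
    have h2 : s • (θ • h z - θ • h (Function.update z j w)) ^ 2 +
        s⁻¹ • (g z - g (Function.update z j w)) ^ 2 ≤ Q := by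
      rw [← smul_sub, smul_pow, smul_smul, ← hQ]
      exact add_le_add (smul_le_smul_of_nonneg_left (hB z w) (by positivity))
        (smul_le_smul_of_nonneg_left (hC z w) (by positivity))
    have h3 := trace_mul_re_mono h2
      ((hherm' z).posSemidef_exp.add (hherm' (Function.update z j w)).posSemidef_exp)
    rw [hΦ, hΦ] at h1 h3
    exact h1.trans (mul_le_mul_of_nonneg_left h3 (by norm_num))
  simp only [hΦ, hQ]
  have hlhs : ∀ z, ((g z - gibbsAt κ j g z) * Φ z).trace.re =
      ∫ w, ((g z - g (Function.update z j w)) * Φ z).trace.re ∂κ j (deleteCoord j z) := by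
    intro z
    have hi := (hg.update j z).integrable (κ j (deleteCoord j z))
    have hL := (traceRe.comp ((ContinuousLinearMap.mul ℝ
      (Matrix (Fin d) (Fin d) ℂ)).flip (Φ z))).integral_comp_comm
        ((integrable_const (g z)).sub hi)
    simp only [Pi.sub_apply] at hL
    rw [integral_sub (integrable_const _) hi] at hL
    simp only [integral_const, probReal_univ, one_smul] at hL
    exact hL.symm
  refine (integral_congr_ae (ae_of_all _ hlhs)).trans_le ?_
  have hg1 : IsBddMeas fun p : (∀ k, E k) × (∀ k, E k) => g p.1 := hg.comp measurable_fst
  have hg2 : IsBddMeas fun p : (∀ k, E k) × (∀ k, E k) => g p.2 := hg.comp measurable_snd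
  have hΦ1 : IsBddMeas fun p : (∀ k, E k) × (∀ k, E k) => Φ p.1 := hΦb.comp measurable_fst
  -- The factor g z - g z' is antisymmetric, so f z z' + f z' z is the trace of (g z - g z')(Φ z - Φ
  -- z'), which `hpt` bounds.
  refine integral_resample_le hπ (f := fun z z' => ((g z - g z') * Φ z).trace.re)
    (((hg1.sub hg2).matrix_mul hΦ1).clm traceRe)
    ((((isBddMeas_const Q).matrix_mul hΦb).clm traceRe).const_smul (1 / 4)) fun z w => ?_
  have h4 := hpt z w
  simp only [Matrix.mul_add, Matrix.mul_sub, Matrix.sub_mul, Matrix.trace_add, Matrix.trace_sub,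
    Complex.add_re, Complex.sub_re] at h4 ⊢
  linarith

lemma traceRe_mul_exp_nonneg {M B : Matrix (Fin d) (Fin d) ℂ} (hM : M.IsHermitian)
    (hB : B.IsHermitian) (θ : ℝ) : 0 ≤ (M ^ 2 * NormedSpace.exp (θ • B)).trace.re := by
  have h1 : (M ^ 2).PosSemidef := by
    have := Matrix.posSemidef_conjTranspose_mul_self M
    rwa [hM.eq, ← pow_two] at this
  exact h1.trace_mul_re_nonneg (Matrix.IsHermitian.posSemidef_exp
    (IsSelfAdjoint.smul (.all θ) hB))

end SteinMethod

/-! ### Summation over coordinates and over Gibbs steps. -/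

section MeanFieldBound

open scoped Matrix.Norms.L2Operator

variable {n d : ℕ} {E : Fin n → Type*} {D : Matrix (Fin n) (Fin n) ℝ}

/-- Here T_k stands for tr(A_k² e^{θh}). The weight s = q^m/θ balances the two contributions: each
becomes at most θ q^m ΣT. The second uses row sums r₁^m and column sums r₂^m together with r₁r₂ ≤
((r₁ + r₂)/2)² ≤ q²; this is how the average of the two norms of D enters. -/
lemma sum_weighted_le (hn : n ≠ 0) (hD1 : inducedNorm 1 D ≤ 1) (hDt : inducedNorm ∞ D ≤ 1)
    {q : ℝ} (hq : 0 < q) (hqD : 1 - (1 - (inducedNorm 1 D + inducedNorm ∞ D) / 2) / n ≤ q)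
    {θ : ℝ} (hθ : 0 < θ) (m : ℕ) {T : Fin n → ℝ} (hT : ∀ k, 0 ≤ T k) :
    ∑ j, 1 / 4 * (q ^ m / θ * θ ^ 2 * T j + (q ^ m / θ)⁻¹ * ((∑ k, (gibbsMatrix D ^ m) j k) *
      ∑ k, (gibbsMatrix D ^ m) j k * T k)) ≤ θ / 2 * q ^ m * ∑ k, T k := by
  set a := inducedNorm 1 D
  set b := inducedNorm ∞ D
  have ha : 0 ≤ a := inducedNorm_nonneg D 1
  have hb : 0 ≤ b := inducedNorm_nonneg D ∞
  have hn1 : (1 : ℝ) ≤ n := Nat.one_le_cast.2 (Nat.one_le_iff_ne_zero.2 hn)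
  have hn0 : (0 : ℝ) < n := by linarith
  have hr : ∀ x : ℝ, 0 ≤ x → x ≤ 1 → 0 ≤ 1 - (1 - x) / n := fun x h0 h1 => by
    rw [sub_nonneg, div_le_one hn0]; linarith
  set r₁ := 1 - (1 - a) / n with hr1
  set r₂ := 1 - (1 - b) / n with hr2
  have h1 : 0 ≤ r₁ := hr a ha hD1
  have h2 : 0 ≤ r₂ := hr b hb hDt
  have hqr : r₁ * r₂ ≤ q * q := by
    have h3 : (r₁ + r₂) / 2 ≤ q := by
      refine le_trans (le_of_eq ?_) hqD
      rw [hr1, hr2]; ring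
    nlinarith [sq_nonneg (r₁ - r₂), mul_self_le_mul_self (by positivity) h3]
  have hpow : r₁ ^ m * r₂ ^ m ≤ q ^ m * q ^ m := by
    rw [← mul_pow, ← mul_pow]
    exact pow_le_pow_left₀ (mul_nonneg h1 h2) hqr m
  have hS : 0 ≤ ∑ k, T k := Finset.sum_nonneg fun k _ => hT k
  have hM := gibbsMatrix_pow_nonneg D m
  have hdouble : ∑ j, (∑ k, (gibbsMatrix D ^ m) j k) * ∑ k, (gibbsMatrix D ^ m) j k * T k ≤
      q ^ m * q ^ m * ∑ k, T k := by
    calc _ ≤ ∑ j, r₁ ^ m * ∑ k, (gibbsMatrix D ^ m) j k * T k :=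
          Finset.sum_le_sum fun j _ => mul_le_mul_of_nonneg_right
            (sum_row_gibbsMatrix_pow_le D (sum_row_gibbsMatrix_le D) h1 m j)
            (Finset.sum_nonneg fun k _ => mul_nonneg (hM j k) (hT k))
      _ = r₁ ^ m * ∑ k, (∑ j, (gibbsMatrix D ^ m) j k) * T k := by
          rw [← Finset.mul_sum, Finset.sum_comm]
          simp only [Finset.sum_mul]
      _ ≤ r₁ ^ m * ∑ k, r₂ ^ m * T k := by
          refine mul_le_mul_of_nonneg_left (Finset.sum_le_sum fun k _ => ?_) (pow_nonneg h1 m)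
          exact mul_le_mul_of_nonneg_right
            (sum_col_gibbsMatrix_pow_le D (sum_col_gibbsMatrix_le D) h2 m k) (hT k)
      _ = r₁ ^ m * r₂ ^ m * ∑ k, T k := by rw [← Finset.mul_sum, mul_assoc]
      _ ≤ _ := mul_le_mul_of_nonneg_right hpow hS
  rw [← Finset.mul_sum, Finset.sum_add_distrib, ← Finset.mul_sum, ← Finset.mul_sum]
  have hqm : 0 < q ^ m := pow_pos hq m
  have h4 := mul_le_mul_of_nonneg_left hdouble (inv_nonneg.2 (div_nonneg hqm.le hθ.le))
  have h5 : (q ^ m / θ)⁻¹ * (q ^ m * q ^ m * ∑ k, T k) = θ * q ^ m * ∑ k, T k := by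
    field_simp
  have h6 : q ^ m / θ * θ ^ 2 * ∑ k, T k = θ * q ^ m * ∑ k, T k := by
    field_simp
  rw [h5] at h4
  rw [h6]
  linarith

variable [∀ k, MeasurableSpace (E k)]
  {κ : ∀ i : Fin n, Kernel (∀ k : {k : Fin n // k ≠ i}, E k) (E i)} [∀ i, IsMarkovKernel (κ i)]
  {π : Measure (∀ k, E k)} [IsProbabilityMeasure π]
  {h : (∀ k, E k) → Matrix (Fin d) (Fin d) ℂ} {A : Fin n → Matrix (Fin d) (Fin d) ℂ}

lemma integral_trace_sub_gibbs_mul_exp_le (hn : n ≠ 0)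
    (hπ : ∀ j, π.map (fun z => (deleteCoord j z, z j)) = (π.map (deleteCoord j)) ⊗ₘ κ j)
    (hD : ∀ (i : Fin n) (x y : ∀ k, E k),
      tvDist (κ i (deleteCoord i x)) (κ i (deleteCoord i y)) ≤
        ∑ j, D i j * ({j | x j ≠ y j} : Set (Fin n)).indicator 1 j)
    (hD1 : inducedNorm 1 D ≤ 1) (hDt : inducedNorm ∞ D ≤ 1)
    (hh : IsBddMeas h) (hherm : ∀ z, (h z).IsHermitian) (hA : ∀ j, (A j).IsHermitian)
    (hdiff : ∀ j z (w : E j), (h z - h (Function.update z j w)) ^ 2 ≤ A j ^ 2)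
    {q : ℝ} (hq : 0 < q) (hqD : 1 - (1 - (inducedNorm 1 D + inducedNorm ∞ D) / 2) / n ≤ q)
    {θ : ℝ} (hθ : 0 < θ) (m : ℕ) :
    ∫ z, (((gibbs κ)^[m] h z - (gibbs κ)^[m + 1] h z) *
        NormedSpace.exp (θ • h z)).trace.re ∂π ≤
      θ / (2 * n) * q ^ m * ∫ z, ((∑ j, A j ^ 2) * NormedSpace.exp (θ • h z)).trace.re ∂π := by
  have hn0 : (n : ℝ) ≠ 0 := Nat.cast_ne_zero.2 hn
  have hg := hh.iterate_gibbs κ m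
  have hgherm := isHermitian_iterate_gibbs (κ := κ) hh hherm m
  have hC := sq_iterate_gibbs_sub_le hD hh hherm hA hdiff m
  rw [Function.iterate_succ']
  simp only [Function.comp_apply]
  set g := (gibbs κ)^[m] h
  have hΦb : IsBddMeas fun z => NormedSpace.exp (θ • h z) := (hh.const_smul θ).matrix_exp
  have hsplit : ∀ z, ((g z - gibbs κ g z) * NormedSpace.exp (θ • h z)).trace.re =
      (n : ℝ)⁻¹ * ∑ j, ((g z - gibbsAt κ j g z) * NormedSpace.exp (θ • h z)).trace.re := by
    intro z
    have h1 : g z - gibbs κ g z = (n : ℝ)⁻¹ • ∑ j, (g z - gibbsAt κ j g z) := by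
      rw [Finset.sum_sub_distrib, smul_sub, gibbs, Finset.sum_const, Finset.card_univ,
        Fintype.card_fin, ← Nat.cast_smul_eq_nsmul ℝ, smul_smul, inv_mul_cancel₀ hn0, one_smul]
    rw [h1, Matrix.smul_mul, Matrix.sum_mul, Matrix.trace_smul, Matrix.trace_sum,
      Complex.smul_re, Complex.re_sum, smul_eq_mul]
  have hint1 : ∀ j, Integrable
      (fun z => ((g z - gibbsAt κ j g z) * NormedSpace.exp (θ • h z)).trace.re) π := fun j =>
    (((hg.sub (hg.gibbsAt κ j)).matrix_mul hΦb).clm traceRe).integrable π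
  have hint2 : ∀ Q : Matrix (Fin d) (Fin d) ℂ, Integrable
      (fun z => (Q * NormedSpace.exp (θ • h z)).trace.re) π := fun Q =>
    (((isBddMeas_const Q).matrix_mul hΦb).clm traceRe).integrable π
  have hs : 0 < q ^ m / θ := div_pos (pow_pos hq m) hθ
  simp only [hsplit]
  rw [integral_const_mul, integral_finsetSum _ fun j _ => hint1 j]
  have hstep : ∑ j, ∫ z, ((g z - gibbsAt κ j g z) * NormedSpace.exp (θ • h z)).trace.re ∂π ≤
      ∫ z, θ / 2 * q ^ m * ((∑ j, A j ^ 2) * NormedSpace.exp (θ • h z)).trace.re ∂π := by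
    refine (Finset.sum_le_sum fun j _ => integral_trace_sub_gibbsAt_mul_exp_le (hπ j) hh hherm hg
      hgherm (hdiff j) (hC j) hs).trans ?_
    rw [← integral_finsetSum _ fun j _ => (hint2 _).const_mul _]
    refine integral_mono (integrable_finsetSum _ fun j _ => (hint2 _).const_mul _)
      ((hint2 _).const_mul _) fun z => ?_
    have hT : ∀ k, 0 ≤ (A k ^ 2 * NormedSpace.exp (θ • h z)).trace.re := fun k =>
      traceRe_mul_exp_nonneg (hA k) (hherm z) θ
    have key := sum_weighted_le hn hD1 hDt hq hqD hθ m hT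
    beta_reduce
    simp only [Matrix.add_mul, Matrix.smul_mul, Matrix.sum_mul, Matrix.trace_add,
      Matrix.trace_smul, Matrix.trace_sum, Complex.add_re, Complex.smul_re, Complex.re_sum,
      smul_eq_mul]
    exact key
  rw [integral_const_mul] at hstep
  calc _ ≤ (n : ℝ)⁻¹ * _ := mul_le_mul_of_nonneg_left hstep (by positivity)
    _ = _ := by field_simp

/-- Stationarity keeps the iterates centred, so their total oscillation bounds them; it contracts by
the largest column sum of the Gibbs matrix at each step. -/
lemma norm_iterate_gibbs_le (hn : n ≠ 0)
    (hπ : ∀ j, π.map (fun z => (deleteCoord j z, z j)) = (π.map (deleteCoord j)) ⊗ₘ κ j)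
    (hD : ∀ (i : Fin n) (x y : ∀ k, E k),
      tvDist (κ i (deleteCoord i x)) (κ i (deleteCoord i y)) ≤
        ∑ j, D i j * ({j | x j ≠ y j} : Set (Fin n)).indicator 1 j)
    {F : Type*} [NormedAddCommGroup F] [NormedSpace ℝ F]
    [CompleteSpace F] {g : (∀ k, E k) → F} (hg : IsBddMeas g) {a : Fin n → ℝ}
    (ha0 : ∀ k, 0 ≤ a k) (ha : HasOscLE g a) (hg0 : ∫ z, g z ∂π = 0) (m : ℕ) (z : ∀ k, E k) :
    ‖(gibbs κ)^[m] g z‖ ≤ (1 - (1 - inducedNorm ∞ D) / n) ^ m * ∑ k, a k := by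
  have hn1 : (1 : ℝ) ≤ n := Nat.one_le_cast.2 (Nat.one_le_iff_ne_zero.2 hn)
  have hr : 0 ≤ 1 - (1 - inducedNorm ∞ D) / n := by
    have := inducedNorm_nonneg D ∞
    rw [sub_nonneg, div_le_one (by linarith)]; linarith
  refine ((ha.iterate_gibbs hD hg m).norm_le_of_integral_eq_zero (hg.iterate_gibbs κ m)
    ((integral_iterate_gibbs hn hπ hg m).trans hg0) z).trans ?_
  simp only [Matrix.mulVec, dotProduct]
  rw [Finset.sum_comm, Finset.mul_sum]
  simp only [← Finset.sum_mul]
  exact Finset.sum_le_sum fun k _ => mul_le_mul_of_nonneg_right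
    (sum_col_gibbsMatrix_pow_le D (sum_col_gibbsMatrix_le D) hr m k) (ha0 k)

lemma integral_trace_mul_exp_le_of_lt (hn : n ≠ 0)
    (hπ : ∀ j, π.map (fun z => (deleteCoord j z, z j)) = (π.map (deleteCoord j)) ⊗ₘ κ j)
    (hD : ∀ (i : Fin n) (x y : ∀ k, E k),
      tvDist (κ i (deleteCoord i x)) (κ i (deleteCoord i y)) ≤
        ∑ j, D i j * ({j | x j ≠ y j} : Set (Fin n)).indicator 1 j)
    (hD1 : inducedNorm 1 D < 1) (hDt : inducedNorm ∞ D < 1)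
    (hh : IsBddMeas h) (hherm : ∀ z, (h z).IsHermitian) (hA : ∀ j, (A j).IsHermitian)
    (hdiff : ∀ j z (w : E j), (h z - h (Function.update z j w)) ^ 2 ≤ A j ^ 2)
    (hh0 : ∫ z, h z ∂π = 0)
    {q : ℝ} (hq : 0 < q) (hq1 : q < 1)
    (hqD : 1 - (1 - (inducedNorm 1 D + inducedNorm ∞ D) / 2) / n ≤ q) {θ : ℝ} (hθ : 0 < θ) :
    ∫ z, (h z * NormedSpace.exp (θ • h z)).trace.re ∂π ≤
      θ / (2 * n) * (1 - q)⁻¹ *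
        ∫ z, ((∑ j, A j ^ 2) * NormedSpace.exp (θ • h z)).trace.re ∂π := by
  have hΦb : IsBddMeas fun z => NormedSpace.exp (θ • h z) := (hh.const_smul θ).matrix_exp
  have hn1 : (1 : ℝ) ≤ n := Nat.one_le_cast.2 (Nat.one_le_iff_ne_zero.2 hn)
  set S := ∫ z, ((∑ j, A j ^ 2) * NormedSpace.exp (θ • h z)).trace.re ∂π with hSdef
  have hS : 0 ≤ S := by
    refine integral_nonneg fun z => ?_
    simp only [Matrix.sum_mul, Matrix.trace_sum, Complex.re_sum]
    exact Finset.sum_nonneg fun j _ => traceRe_mul_exp_nonneg (hA j) (hherm z) θ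
  have hint : ∀ m, Integrable
      (fun z => ((gibbs κ)^[m] h z * NormedSpace.exp (θ • h z)).trace.re) π := fun m =>
    (((hh.iterate_gibbs κ m).matrix_mul hΦb).clm traceRe).integrable π
  -- Finite telescoping: N Gibbs steps leave a remainder, which tends to zero by the uniform decay
  -- of the iterates.
  have htel : ∀ N : ℕ, ∫ z, (h z * NormedSpace.exp (θ • h z)).trace.re ∂π ≤
      (∑ m ∈ Finset.range N, θ / (2 * n) * q ^ m * S) +
        ∫ z, ((gibbs κ)^[N] h z * NormedSpace.exp (θ • h z)).trace.re ∂π := by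
    intro N
    induction N with
    | zero => simp
    | succ N ih =>
      have h1 := integral_trace_sub_gibbs_mul_exp_le hn hπ hD hD1.le hDt.le hh hherm hA hdiff hq
        hqD hθ N
      simp only [Matrix.sub_mul, Matrix.trace_sub, Complex.sub_re] at h1
      rw [integral_sub (hint N) (hint (N + 1))] at h1
      rw [Finset.sum_range_succ]
      linarith
  obtain ⟨K, hK⟩ := hΦb.2
  set r := 1 - (1 - inducedNorm ∞ D) / n with hrdef
  have hr0 : 0 ≤ r := by
    have := inducedNorm_nonneg D ∞
    rw [hrdef, sub_nonneg, div_le_one (by linarith)]; linarith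
  have hr1 : r < 1 := by
    have : 0 < (1 - inducedNorm ∞ D) / n := div_pos (by linarith) (by linarith)
    linarith
  have hosc := hasOscLE_of_sq_le hherm hA hdiff
  have hrem : ∀ N : ℕ, ∫ z, ((gibbs κ)^[N] h z * NormedSpace.exp (θ • h z)).trace.re ∂π ≤
      ‖traceRe (d := d)‖ * (r ^ N * (∑ k, ‖A k‖) * K) := by
    intro N
    refine (le_abs_self _).trans ?_
    rw [← Real.norm_eq_abs]
    refine (norm_integral_le_of_norm_le_const (C := ‖traceRe (d := d)‖ *
      (r ^ N * (∑ k, ‖A k‖) * K)) (ae_of_all _ fun z => ?_)).trans (by simp)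
    refine (traceRe.le_opNorm _).trans (mul_le_mul_of_nonneg_left ?_ (norm_nonneg _))
    refine (norm_mul_le _ _).trans (mul_le_mul ?_ (hK z) (norm_nonneg _) ?_)
    · exact norm_iterate_gibbs_le hn hπ hD hh (fun k => norm_nonneg _) hosc hh0 N z
    · exact mul_nonneg (pow_nonneg hr0 N) (Finset.sum_nonneg fun k _ => norm_nonneg _)
  have hgeom : ∀ N : ℕ, ∑ m ∈ Finset.range N, θ / (2 * n) * q ^ m * S ≤
      θ / (2 * n) * (1 - q)⁻¹ * S := by
    intro N
    rw [← Finset.sum_mul, ← Finset.mul_sum]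
    have h1 : ∑ m ∈ Finset.range N, q ^ m ≤ (1 - q)⁻¹ := by
      rw [← tsum_geometric_of_lt_one hq.le hq1]
      exact (summable_geometric_of_lt_one hq.le hq1).sum_le_tsum _ fun m _ => pow_nonneg hq.le m
    gcongr
  have hlim : Filter.Tendsto (fun N : ℕ => θ / (2 * n) * (1 - q)⁻¹ * S +
      ‖traceRe (d := d)‖ * (r ^ N * (∑ k, ‖A k‖) * K)) Filter.atTop
      (nhds (θ / (2 * n) * (1 - q)⁻¹ * S + ‖traceRe (d := d)‖ * (0 * (∑ k, ‖A k‖) * K))) :=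
    tendsto_const_nhds.add (tendsto_const_nhds.mul
      (((tendsto_pow_atTop_nhds_zero_of_lt_one hr0 hr1).mul_const _).mul_const _))
  have := ge_of_tendsto' hlim fun N => (htel N).trans (add_le_add (hgeom N) (hrem N))
  simpa using this

/-- The differential inequality for the trace moment generating function. -/
theorem integral_trace_mul_exp_le
    (hπ : ∀ j, π.map (fun z => (deleteCoord j z, z j)) = (π.map (deleteCoord j)) ⊗ₘ κ j)
    (hD : ∀ (i : Fin n) (x y : ∀ k, E k),
      tvDist (κ i (deleteCoord i x)) (κ i (deleteCoord i y)) ≤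
        ∑ j, D i j * ({j | x j ≠ y j} : Set (Fin n)).indicator 1 j)
    (hD1 : inducedNorm 1 D < 1) (hDt : inducedNorm ∞ D < 1)
    (hh : IsBddMeas h) (hherm : ∀ z, (h z).IsHermitian) (hA : ∀ j, (A j).IsHermitian)
    (hdiff : ∀ j z (w : E j), (h z - h (Function.update z j w)) ^ 2 ≤ A j ^ 2)
    (hh0 : ∫ z, h z ∂π = 0) {θ : ℝ} (hθ : 0 < θ) :
    ∫ z, (h z * NormedSpace.exp (θ • h z)).trace.re ∂π ≤
      θ / 2 * (1 - (inducedNorm 1 D + inducedNorm ∞ D) / 2)⁻¹ * specNorm (∑ j, A j ^ 2) *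
        ∫ z, (NormedSpace.exp (θ • h z)).trace.re ∂π := by
  have hΦb : IsBddMeas fun z => NormedSpace.exp (θ • h z) := (hh.const_smul θ).matrix_exp
  have hpos : 0 < 1 - (inducedNorm 1 D + inducedNorm ∞ D) / 2 := by linarith
  have hexp : ∀ z, (NormedSpace.exp (θ • h z)).PosSemidef := fun z =>
    Matrix.IsHermitian.posSemidef_exp (IsSelfAdjoint.smul (.all θ) (hherm z))
  have hm0 : 0 ≤ ∫ z, (NormedSpace.exp (θ • h z)).trace.re ∂π :=
    integral_nonneg fun z => (Complex.le_def.1 (hexp z).trace_nonneg).1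
  have hSm : ∫ z, ((∑ j, A j ^ 2) * NormedSpace.exp (θ • h z)).trace.re ∂π ≤
      specNorm (∑ j, A j ^ 2) * ∫ z, (NormedSpace.exp (θ • h z)).trace.re ∂π := by
    rw [← integral_const_mul]
    refine integral_mono ((((isBddMeas_const _).matrix_mul hΦb).clm traceRe).integrable π)
      (((hΦb.clm traceRe).integrable π).const_mul _) fun z => ?_
    exact trace_mul_re_le_specNorm (isSelfAdjoint_sum _ fun j _ => (hA j).pow 2) (hexp z)
  -- Without coordinates h is constant, and being centred it vanishes.
  rcases eq_or_ne n 0 with rfl | hn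
  · have hz : ∀ z, h z = 0 := fun z => by
      have := (hasOscLE_of_sq_le hherm hA hdiff).norm_le_of_integral_eq_zero hh hh0 z
      simpa using this
    simp only [hz, Matrix.zero_mul, Matrix.trace_zero, Complex.zero_re, integral_zero]
    simp only [hz] at hm0
    have : 0 ≤ specNorm (∑ j, A j ^ 2) := norm_nonneg _
    positivity
  have hn1 : (1 : ℝ) ≤ n := Nat.one_le_cast.2 (Nat.one_le_iff_ne_zero.2 hn)
  have hn0 : (0 : ℝ) < n := by linarith
  set δ := 1 - (inducedNorm 1 D + inducedNorm ∞ D) / 2 with hδ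
  set S := ∫ z, ((∑ j, A j ^ 2) * NormedSpace.exp (θ • h z)).trace.re ∂π with hSdef
  set T := ∫ z, (h z * NormedSpace.exp (θ • h z)).trace.re ∂π
  have hδ1 : δ ≤ 1 := by
    have := inducedNorm_nonneg D 1
    have := inducedNorm_nonneg D ∞
    linarith
  have hq0 : 0 ≤ 1 - δ / n := by
    rw [sub_nonneg, div_le_one hn0]; linarith
  have hq1 : 1 - δ / n < 1 := by
    have : 0 < δ / n := div_pos hpos hn0
    linarith
  have hcont : Filter.Tendsto (fun q : ℝ => θ / (2 * n) * (1 - q)⁻¹ * S)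
      (nhdsWithin (1 - δ / n) (Set.Ioi (1 - δ / n)))
      (nhds (θ / (2 * n) * (1 - (1 - δ / n))⁻¹ * S)) := by
    refine Filter.Tendsto.mono_left ?_ nhdsWithin_le_nhds
    refine ((tendsto_const_nhds.sub Filter.tendsto_id).inv₀ ?_).const_mul _ |>.mul_const _
    have : 0 < δ / n := div_pos hpos hn0
    rw [sub_sub_cancel]
    exact this.ne'
  -- The optimal ratio 1 - δ/n can be 0 (for n = 1 and D = 0), whereas the weight q^m/θ must be
  -- positive. Hence the bound is taken for q slightly larger, and then q decreases to the optimum.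
  have hT : T ≤ θ / (2 * n) * (1 - (1 - δ / n))⁻¹ * S := by
    refine ge_of_tendsto hcont ?_
    filter_upwards [Ioo_mem_nhdsGT hq1] with q hq
    exact integral_trace_mul_exp_le_of_lt hn hπ hD hD1 hDt hh hherm hA hdiff hh0
      (hq0.trans_lt hq.1) hq.2 hq.1.le hθ
  -- The factor 1/n from the random choice of coordinate cancels against the sum n/δ of the
  -- geometric series.
  calc T ≤ θ / (2 * n) * (1 - (1 - δ / n))⁻¹ * S := hT
    _ = θ / 2 * δ⁻¹ * S := by
        rw [sub_sub_cancel]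
        field_simp
    _ ≤ θ / 2 * δ⁻¹ * _ := mul_le_mul_of_nonneg_left hSm (by positivity)
    _ = _ := by ring

end MeanFieldBound

/-! ### Trace moment generating function, tails and mean. -/

section LaplaceTransform

open scoped Matrix.Norms.L2Operator

variable {d : ℕ} {Ω : Type*} [MeasurableSpace Ω] {P : Measure Ω} [IsProbabilityMeasure P]
  {X : Ω → Matrix (Fin d) (Fin d) ℂ}

/-- For fixed ω the eigenvalues of X ω do not depend on θ, so only scalar exponentials are
differentiated, under a uniform bound on the unit ball around θ. -/
lemma hasDerivAt_integral_trace_exp (hX : IsBddMeas X) (hherm : ∀ ω, (X ω).IsHermitian) (θ : ℝ) :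
    HasDerivAt (fun t : ℝ => ∫ ω, (NormedSpace.exp (t • X ω)).trace.re ∂P)
      (∫ ω, (X ω * NormedSpace.exp (θ • X ω)).trace.re ∂P) θ := by
  obtain ⟨K, hK⟩ := hX.2
  have hK0 : 0 ≤ K := by
    obtain ⟨ω⟩ : Nonempty Ω := P.nonempty_of_neZero
    exact (norm_nonneg _).trans (hK ω)
  have hexp : ∀ t : ℝ, IsBddMeas fun ω => NormedSpace.exp (t • X ω) := fun t =>
    (hX.const_smul t).matrix_exp
  refine (hasDerivAt_integral_of_dominated_loc_of_deriv_le
    (F := fun t ω => (NormedSpace.exp (t • X ω)).trace.re)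
    (F' := fun t ω => (X ω * NormedSpace.exp (t • X ω)).trace.re)
    (bound := fun _ => ∑ _i : Fin d, K * Real.exp ((|θ| + 1) * K))
    (Metric.ball_mem_nhds θ one_pos)
    (Filter.Eventually.of_forall fun t => ((hexp t).clm traceRe).1.aestronglyMeasurable)
    (((hexp θ).clm traceRe).integrable P)
    ((hX.matrix_mul (hexp θ)).clm traceRe).1.aestronglyMeasurable
    (ae_of_all _ fun ω t ht => ?_) (integrable_const _) (ae_of_all _ fun ω t _ => ?_)).2
  · rw [(hherm ω).trace_mul_exp]
    refine (norm_sum_le _ _).trans (Finset.sum_le_sum fun i _ => ?_)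
    have hev : |(hherm ω).eigenvalues i| ≤ K := ((hherm ω).abs_eigenvalues_le_norm i).trans (hK ω)
    rw [norm_mul, Real.norm_eq_abs, Real.norm_of_nonneg (Real.exp_pos _).le]
    refine mul_le_mul hev (Real.exp_le_exp.2 ?_) (Real.exp_pos _).le hK0
    have ht' : |t| ≤ |θ| + 1 := by
      have h1 : |t - θ| < 1 := by simpa [Real.dist_eq] using ht
      have h2 := abs_sub_abs_le_abs_sub t θ
      linarith
    calc t * (hherm ω).eigenvalues i ≤ |t * (hherm ω).eigenvalues i| := le_abs_self _
      _ = |t| * |(hherm ω).eigenvalues i| := abs_mul _ _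
      _ ≤ (|θ| + 1) * K := mul_le_mul ht' hev (abs_nonneg _) (by positivity)
  · simp only [(hherm ω).trace_exp, (hherm ω).trace_mul_exp]
    refine HasDerivAt.fun_sum fun i _ => ?_
    have h1 := ((hasDerivAt_id t).mul_const ((hherm ω).eigenvalues i)).exp
    simpa [mul_comm] using h1

/-- A differential inequality for the trace moment generating function yields a subgaussian
bound. -/
lemma integral_trace_exp_le_of_deriv_le (hX : IsBddMeas X) (hherm : ∀ ω, (X ω).IsHermitian)
    {v : ℝ} (hv : ∀ θ : ℝ, 0 < θ → ∫ ω, (X ω * NormedSpace.exp (θ • X ω)).trace.re ∂P ≤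
      θ / 2 * v * ∫ ω, (NormedSpace.exp (θ • X ω)).trace.re ∂P) {θ : ℝ} (hθ : 0 ≤ θ) :
    ∫ ω, (NormedSpace.exp (θ • X ω)).trace.re ∂P ≤ d * Real.exp (v * θ ^ 2 / 4) := by
  set m : ℝ → ℝ := fun t => ∫ ω, (NormedSpace.exp (t • X ω)).trace.re ∂P with hm
  -- The integrating factor e^{-vt²/4} turns the differential inequality into monotonicity, starting
  -- from m(0) = d.
  have hderiv : ∀ t, HasDerivAt (fun t => m t * Real.exp (-(v * t ^ 2 / 4)))
      ((∫ ω, (X ω * NormedSpace.exp (t • X ω)).trace.re ∂P) * Real.exp (-(v * t ^ 2 / 4)) +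
        m t * (Real.exp (-(v * t ^ 2 / 4)) * (-(t / 2 * v)))) t := by
    intro t
    refine (hasDerivAt_integral_trace_exp hX hherm t).mul (HasDerivAt.exp ?_)
    have h1 := (((hasDerivAt_pow 2 t).const_mul v).div_const 4).neg
    convert! h1 using 1
    simp
    ring
  have hanti : AntitoneOn (fun t => m t * Real.exp (-(v * t ^ 2 / 4))) (Set.Ici 0) := by
    refine antitoneOn_of_deriv_nonpos (convex_Ici 0)
      (fun t _ => (hderiv t).continuousAt.continuousWithinAt)
      (fun t _ => (hderiv t).differentiableAt.differentiableWithinAt) fun t ht => ?_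
    rw [interior_Ici, Set.mem_Ioi] at ht
    rw [(hderiv t).deriv]
    have h1 := mul_le_mul_of_nonneg_right (hv t ht) (Real.exp_pos (-(v * t ^ 2 / 4))).le
    linarith
  have h0 : m 0 = d := by
    simp [hm]
  have h1 := hanti (Set.mem_Ici.2 le_rfl) (Set.mem_Ici.2 hθ) hθ
  simp only [h0] at h1
  have h2 := mul_le_mul_of_nonneg_right h1 (Real.exp_pos (v * θ ^ 2 / 4)).le
  rw [mul_assoc, ← Real.exp_add, neg_add_cancel, Real.exp_zero, mul_one] at h2
  simpa using h2

/-- λ_max is the limit of k⁻¹ log tr e^{kX}, which for k > 0 lies between λ_max and λ_max + k⁻¹ log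
d. -/
lemma measurable_lambdaMax (hd : 1 ≤ d) (hX : StronglyMeasurable X)
    (hherm : ∀ ω, (X ω).IsHermitian) : Measurable fun ω => lambdaMax (X ω) := by
  have hd0 : (0 : ℝ) < d := by exact_mod_cast hd
  refine measurable_of_tendsto_metrizable
    (f := fun (k : ℕ) ω => (k : ℝ)⁻¹ * Real.log (NormedSpace.exp ((k : ℝ) • X ω)).trace.re)
    (fun k => ?_) (tendsto_pi_nhds.2 fun ω => ?_)
  · refine (Real.measurable_log.comp ?_).const_mul _
    exact (traceRe.continuous.comp_stronglyMeasurable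
      (continuous_matrix_exp.comp_stronglyMeasurable (hX.const_smul (k : ℝ)))).measurable
  · have hlim : Filter.Tendsto (fun k : ℕ => (k : ℝ)⁻¹ * Real.log d + lambdaMax (X ω))
        Filter.atTop (nhds (0 * Real.log d + lambdaMax (X ω))) :=
      (tendsto_inv_atTop_nhds_zero_nat.mul_const _).add_const _
    rw [zero_mul, zero_add] at hlim
    refine tendsto_of_tendsto_of_tendsto_of_le_of_le' tendsto_const_nhds hlim ?_ ?_
    · filter_upwards [Filter.eventually_gt_atTop 0] with k hk
      have hk' : (0 : ℝ) < k := Nat.cast_pos.2 hk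
      rw [le_inv_mul_iff₀ hk', Real.le_log_iff_exp_le]
      · exact (hherm ω).exp_lambdaMax_le hd k
      · exact (Real.exp_pos _).trans_le ((hherm ω).exp_lambdaMax_le hd k)
    · filter_upwards [Filter.eventually_gt_atTop 0] with k hk
      have hk' : (0 : ℝ) < k := Nat.cast_pos.2 hk
      have h1 := Real.log_le_log ((Real.exp_pos _).trans_le ((hherm ω).exp_lambdaMax_le hd k))
        ((hherm ω).trace_exp_le hk'.le)
      rw [Real.log_mul hd0.ne' (Real.exp_pos _).ne', Real.log_exp] at h1
      rw [inv_mul_le_iff₀ hk', mul_add, mul_inv_cancel_left₀ hk'.ne']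
      exact h1

lemma integrable_lambdaMax (hd : 1 ≤ d) (hX : StronglyMeasurable X)
    (hherm : ∀ ω, (X ω).IsHermitian) {K : ℝ} (hK : ∀ᵐ ω ∂P, ‖X ω‖ ≤ K) :
    Integrable (fun ω => lambdaMax (X ω)) P := by
  refine Integrable.of_bound (measurable_lambdaMax hd hX hherm).aestronglyMeasurable K ?_
  filter_upwards [hK] with ω hω
  obtain ⟨i, hi⟩ := (hherm ω).exists_eigenvalues_eq_lambdaMax hd
  rw [← hi]
  exact ((hherm ω).abs_eigenvalues_le_norm i).trans hω

lemma integrable_trace_exp (hX : StronglyMeasurable X) {K : ℝ} (hK : ∀ᵐ ω ∂P, ‖X ω‖ ≤ K) (θ : ℝ) :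
    Integrable (fun ω => (NormedSpace.exp (θ • X ω)).trace.re) P := by
  have hc : Continuous fun M : Matrix (Fin d) (Fin d) ℂ => traceRe (NormedSpace.exp (θ • M)) :=
    traceRe.continuous.comp (continuous_matrix_exp.comp (continuous_const_smul θ))
  obtain ⟨C, hC⟩ := (isCompact_closedBall (0 : Matrix (Fin d) (Fin d) ℂ)
    K).exists_bound_of_continuousOn hc.continuousOn
  refine Integrable.of_bound (hc.comp_stronglyMeasurable hX).aestronglyMeasurable C ?_
  filter_upwards [hK] with ω hω
  exact hC _ (mem_closedBall_zero_iff.2 hω)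

/-- The matrix Laplace transform bound for tails. -/
lemma measureReal_lambdaMax_ge_le (hd : 1 ≤ d) (hX : StronglyMeasurable X)
    (hherm : ∀ ω, (X ω).IsHermitian) {K : ℝ} (hK : ∀ᵐ ω ∂P, ‖X ω‖ ≤ K) {v : ℝ}
    (hv : ∀ θ : ℝ, 0 ≤ θ →
      ∫ ω, (NormedSpace.exp (θ • X ω)).trace.re ∂P ≤ d * Real.exp (v * θ ^ 2 / 4))
    {θ : ℝ} (hθ : 0 ≤ θ) (t : ℝ) :
    P.real {ω | t ≤ lambdaMax (X ω)} ≤ d * Real.exp (v * θ ^ 2 / 4 - θ * t) := by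
  have h1 : P.real {ω | t ≤ lambdaMax (X ω)} ≤
      P.real {ω | Real.exp (θ * t) ≤ (NormedSpace.exp (θ • X ω)).trace.re} := by
    refine measureReal_mono fun ω hω => ?_
    exact (Real.exp_le_exp.2 (mul_le_mul_of_nonneg_left hω hθ)).trans
      ((hherm ω).exp_lambdaMax_le hd θ)
  have h2 := mul_meas_ge_le_integral_of_nonneg (μ := P)
    (ae_of_all _ fun ω => ((Real.exp_pos _).trans_le ((hherm ω).exp_lambdaMax_le hd θ)).le)
    (integrable_trace_exp hX hK θ) (Real.exp (θ * t))
  have h3 := h2.trans (hv θ hθ)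
  rw [Real.exp_sub, ← mul_div_assoc, le_div_iff₀ (Real.exp_pos _), mul_comm]
  exact (mul_le_mul_of_nonneg_left h1 (Real.exp_pos _).le).trans h3

/-- The right side divided by θ has minimum √(vL) when v, L > 0. The choice θ = 2L/x is the
minimizer at x = √(vL) and avoids division by v. For L = 0, which occurs when d = 1, a small
multiple of x serves instead; v + 1 covers v = 0. -/
lemma le_sqrt_of_forall_le {x L v : ℝ} (hL : 0 ≤ L) (hv : 0 ≤ v)
    (h : ∀ θ : ℝ, 0 < θ → θ * x ≤ L + v * θ ^ 2 / 4) : x ≤ Real.sqrt (v * L) := by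
  by_contra! hx
  have hx0 : 0 < x := (Real.sqrt_nonneg _).trans_lt hx
  have hx2 : v * L < x ^ 2 := (Real.sqrt_lt' hx0).1 hx
  rcases hL.eq_or_lt with rfl | hL
  · have hpos : 0 < 2 * x / (v + 1) := by positivity
    have h1 := h _ hpos
    have h2 : 2 * x / (v + 1) * x = 2 * x ^ 2 / (v + 1) := by ring
    have h3 : v * (2 * x / (v + 1)) ^ 2 / 4 = v / (v + 1) * (x ^ 2 / (v + 1)) := by
      field_simp
      ring
    have h4 : v / (v + 1) ≤ 1 := by rw [div_le_one (by linarith)]; linarith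
    have h5 : 0 < x ^ 2 / (v + 1) := by positivity
    have h6 := mul_le_mul_of_nonneg_right h4 h5.le
    have h7 : 2 * x ^ 2 / (v + 1) = 2 * (x ^ 2 / (v + 1)) := by ring
    rw [h2, h3, h7] at h1
    linarith
  · have h1 := h (2 * L / x) (by positivity)
    have h2 : 2 * L / x * x = 2 * L := by field_simp
    have h3 : v * (2 * L / x) ^ 2 / 4 = v * L / x ^ 2 * L := by
      field_simp
      ring
    have h4 : v * L / x ^ 2 < 1 := (div_lt_one (by positivity)).2 hx2
    have h5 := mul_lt_mul_of_pos_right h4 hL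
    rw [h2, h3] at h1
    linarith

/-- The matrix Laplace transform bound for the mean. -/
lemma integral_lambdaMax_le (hd : 1 ≤ d) (hX : StronglyMeasurable X)
    (hherm : ∀ ω, (X ω).IsHermitian) {K : ℝ} (hK : ∀ᵐ ω ∂P, ‖X ω‖ ≤ K) {v : ℝ} (hv0 : 0 ≤ v)
    (hv : ∀ θ : ℝ, 0 ≤ θ →
      ∫ ω, (NormedSpace.exp (θ • X ω)).trace.re ∂P ≤ d * Real.exp (v * θ ^ 2 / 4)) :
    ∫ ω, lambdaMax (X ω) ∂P ≤ Real.sqrt (v * Real.log d) := by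
  have hd1 : (1 : ℝ) ≤ d := by exact_mod_cast hd
  refine le_sqrt_of_forall_le (Real.log_nonneg hd1) hv0 fun θ hθ => ?_
  set c := Real.log d + v * θ ^ 2 / 4 with hc
  have hcexp : Real.exp c = d * Real.exp (v * θ ^ 2 / 4) := by
    rw [hc, Real.exp_add, Real.exp_log (by linarith)]
  have hint := integrable_lambdaMax hd hX hherm hK
  have hint2 := integrable_trace_exp hX hK θ
  -- Jensen's inequality through the tangent line y + 1 ≤ e^y at y = θλ_max - c; the value of c
  -- makes the mean of the right side at most 1.
  have h1 : ∫ ω, (θ * lambdaMax (X ω) - (c - 1)) ∂P ≤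
      ∫ ω, Real.exp (-c) * (NormedSpace.exp (θ • X ω)).trace.re ∂P := by
    refine integral_mono ((hint.const_mul θ).sub (integrable_const (c - 1)))
      (hint2.const_mul _) fun ω => ?_
    calc θ * lambdaMax (X ω) - (c - 1) = θ * lambdaMax (X ω) - c + 1 := by ring
      _ ≤ Real.exp (θ * lambdaMax (X ω) - c) := Real.add_one_le_exp _
      _ = Real.exp (-c) * Real.exp (θ * lambdaMax (X ω)) := by
          rw [← Real.exp_add]; ring_nf
      _ ≤ _ := mul_le_mul_of_nonneg_left ((hherm ω).exp_lambdaMax_le hd θ) (Real.exp_pos _).le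
  rw [integral_const_mul, integral_sub (hint.const_mul θ) (integrable_const (c - 1)),
    integral_const_mul] at h1
  simp only [integral_const, probReal_univ, one_smul] at h1
  have h2 := mul_le_mul_of_nonneg_left (hv θ hθ.le) (Real.exp_pos (-c)).le
  rw [← hcexp, ← Real.exp_add, neg_add_cancel, Real.exp_zero] at h2
  linarith

end LaplaceTransform

/-! ### Retraction onto the possible values. -/

section ProductSupport

variable {n : ℕ} {E : Fin n → Type*}

open scoped Classical in
/-- Retraction of the product space onto a product of sets. -/
noncomputable def retract (S : ∀ k, Set (E k)) (s₀ : ∀ k, E k) (z : ∀ k, E k) : ∀ k, E k :=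
  fun k => if z k ∈ S k then z k else s₀ k

variable {S : ∀ k, Set (E k)} {s₀ : ∀ k, E k}

lemma retract_mem (hs₀ : ∀ k, s₀ k ∈ S k) (z : ∀ k, E k) (k : Fin n) : retract S s₀ z k ∈ S k := by
  unfold retract
  split_ifs with h
  · exact h
  · exact hs₀ k

lemma retract_eq_self {z : ∀ k, E k} (hz : ∀ k, z k ∈ S k) : retract S s₀ z = z :=
  funext fun k => if_pos (hz k)

/-- The retraction acts coordinatewise, so a one-coordinate change remains one. Hence differences
bounded on the product of the `S k` become bounded everywhere after composition. -/
lemma retract_update (z : ∀ k, E k) (j : Fin n) (w : E j) :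
    retract S s₀ (Function.update z j w) =
      Function.update (retract S s₀ z) j (retract S s₀ (Function.update z j w) j) := by
  ext k
  by_cases h : k = j
  · subst h; simp
  · rw [Function.update_of_ne h]
    unfold retract
    rw [Function.update_of_ne h]

lemma measurable_retract [∀ k, MeasurableSpace (E k)] (hS : ∀ k, MeasurableSet (S k)) :
    Measurable (retract S s₀) := by
  classical
  refine measurable_pi_lambda _ fun k => ?_
  exact Measurable.ite (hS k |>.preimage (measurable_pi_apply k)) (measurable_pi_apply k)
    measurable_const

end ProductSupport

/-! ### Reduction to the law of `Z` and the final theorem. -/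

section BoundedDifferences

open scoped Matrix.Norms.L2Operator

lemma stronglyMeasurable_matrix_of_entries {α : Type*} [MeasurableSpace α] {d : ℕ}
    {f : α → Matrix (Fin d) (Fin d) ℂ} (hf : ∀ a b, Measurable fun x => f x a b) :
    StronglyMeasurable f := by
  have h : Measurable (fun x a b => f x a b : α → Fin d → Fin d → ℂ) :=
    measurable_pi_lambda _ fun a => measurable_pi_lambda _ fun b => hf a b
  exact h.stronglyMeasurable

lemma integral_matrix_apply {α : Type*} [MeasurableSpace α] {μ : Measure α} {d : ℕ}
    {f : α → Matrix (Fin d) (Fin d) ℂ} (hf : Integrable f μ) (a b : Fin d) :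
    (∫ x, f x ∂μ) a b = ∫ x, f x a b ∂μ :=
  ((LinearMap.toContinuousLinearMap (Matrix.entryLinearMap ℝ ℂ a b)).integral_comp_comm hf).symm

lemma isHermitian_integral {α : Type*} [MeasurableSpace α] {μ : Measure α} {d : ℕ}
    {f : α → Matrix (Fin d) (Fin d) ℂ} (hf : Integrable f μ) (hherm : ∀ x, (f x).IsHermitian) :
    (∫ x, f x ∂μ).IsHermitian := by
  have h := conjTransposeCLM.integral_comp_comm hf
  have h2 : (fun x => conjTransposeCLM (f x)) = f := funext fun x => (hherm x).eq
  rw [h2] at h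
  exact h.symm

end BoundedDifferences

open scoped Matrix.Norms.L2Operator in
/-- Reduction of the bounded differences hypotheses to a subgaussian bound on the trace moment
generating function of the centred random matrix. -/
lemma exists_integral_trace_exp_le {Ω : Type*} [MeasurableSpace Ω] (P : Measure Ω)
    [IsProbabilityMeasure P] {n d : ℕ} {E : Fin n → Type*} [∀ k, MeasurableSpace (E k)]
    (Z : ∀ k, Ω → E k) (hZ : ∀ k, Measurable (Z k))
    (D : Matrix (Fin n) (Fin n) ℝ) (hD : IsDobrushinMatrix P Z D)
    (hD1 : inducedNorm 1 D < 1) (hDt : inducedNorm ∞ D < 1)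
    (S : ∀ k, Set (E k)) (hS : ∀ k, MeasurableSet (S k)) (hZS : ∀ k, ∀ᵐ ω ∂P, Z k ω ∈ S k)
    (H : (∀ k, E k) → Matrix (Fin d) (Fin d) ℂ) (hH_herm : ∀ z, (H z).IsHermitian)
    (hH_meas : ∀ a b, Measurable fun z => H z a b)
    (A : Fin n → Matrix (Fin d) (Fin d) ℂ) (hA : ∀ j, (A j).IsHermitian)
    (hdiff : ∀ (j : Fin n) (z : ∀ k, E k) (w : E j), (∀ k, z k ∈ S k) → w ∈ S j →
      (H z - H (Function.update z j w)) ^ 2 ≤ A j ^ 2) :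
    let Y : Ω → Matrix (Fin d) (Fin d) ℂ := fun ω => H (fun k => Z k ω)
    let X : Ω → Matrix (Fin d) (Fin d) ℂ := fun ω => Y ω - expect P Y
    (∀ p q, Integrable (fun ω => Y ω p q) P) ∧ StronglyMeasurable X ∧ (∀ ω, (X ω).IsHermitian) ∧
      (∃ K : ℝ, ∀ᵐ ω ∂P, ‖X ω‖ ≤ K) ∧
      ∀ θ : ℝ, 0 ≤ θ → ∫ ω, (NormedSpace.exp (θ • X ω)).trace.re ∂P ≤
        d * Real.exp ((1 - (inducedNorm 1 D + inducedNorm ∞ D) / 2)⁻¹ *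
          specNorm (∑ j, A j ^ 2) * θ ^ 2 / 4) := by
  intro Y X
  obtain ⟨-, κ, hκ, hcond, htv⟩ := hD
  have hZm : Measurable fun ω k => Z k ω := measurable_pi_lambda _ hZ
  have hall : ∀ᵐ ω ∂P, ∀ k, Z k ω ∈ S k := ae_all_iff.2 hZS
  obtain ⟨ω₀, hω₀⟩ := hall.exists
  -- A realized value of Z lying in all the sets `S k` serves as the default point of the
  -- retraction.
  set s₀ : ∀ k, E k := fun k => Z k ω₀
  set π := P.map fun ω k => Z k ω with hπdef
  have hπp : IsProbabilityMeasure π := Measure.isProbabilityMeasure_map hZm.aemeasurable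
  have hπ : ∀ j, π.map (fun z => (deleteCoord j z, z j)) = (π.map (deleteCoord j)) ⊗ₘ κ j := by
    intro j
    have hdel := measurable_deleteCoord (E := E) j
    rw [hπdef, Measure.map_map (hdel.prodMk (measurable_pi_apply j)) hZm,
      Measure.map_map hdel hZm]
    exact (hcond j).map_eq
  -- the modification of `H` with bounded differences everywhere
  set G : (∀ k, E k) → Matrix (Fin d) (Fin d) ℂ := fun z => H (retract S s₀ z) with hG
  have hGherm : ∀ z, (G z).IsHermitian := fun z => hH_herm _
  have hGdiff : ∀ j z (w : E j), (G z - G (Function.update z j w)) ^ 2 ≤ A j ^ 2 := by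
    intro j z w
    simp only [hG]
    rw [retract_update]
    exact hdiff j _ _ (retract_mem hω₀ z) (retract_mem hω₀ _ j)
  have hGmeas : ∀ a b, Measurable fun z => G z a b := fun a b =>
    (hH_meas a b).comp (measurable_retract hS)
  have hGb : IsBddMeas G := by
    refine ⟨stronglyMeasurable_matrix_of_entries hGmeas, ∑ j, ‖A j‖ + ‖G s₀‖, fun z => ?_⟩
    have h1 := (hasOscLE_of_sq_le hGherm hA hGdiff).norm_sub_le z s₀
    have h2 := norm_le_norm_sub_add (G z) (G s₀)
    linarith
  set M := ∫ z, G z ∂π with hM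
  have hMherm : M.IsHermitian := isHermitian_integral (hGb.integrable π) hGherm
  have hYG : ∀ᵐ ω ∂P, G (fun k => Z k ω) = Y ω := by
    filter_upwards [hall] with ω hω
    simp only [hG, Y]
    rw [retract_eq_self hω]
  have hexpect : expect P Y = M := by
    ext a b
    rw [hM, integral_matrix_apply (hGb.integrable π), hπdef,
      integral_map_of_stronglyMeasurable hZm (hGmeas a b).stronglyMeasurable]
    refine integral_congr_ae ?_
    filter_upwards [hYG] with ω hω
    rw [hω]
  have hYmeas : StronglyMeasurable Y := stronglyMeasurable_matrix_of_entries fun a b =>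
    (hH_meas a b).comp hZm
  have hhb : IsBddMeas fun z => G z - M := hGb.sub (isBddMeas_const M)
  have hXh : ∀ᵐ ω ∂P, (fun z => G z - M) (fun k => Z k ω) = X ω := by
    filter_upwards [hYG] with ω hω
    simp only [X]
    rw [hω, hexpect]
  refine ⟨fun p q => ?_, hYmeas.sub stronglyMeasurable_const, fun ω => ?_, ?_, fun θ hθ => ?_⟩
  · have h1 : Integrable (fun ω => G (fun k => Z k ω) p q) P :=
      ((hGb.comp hZm).clm (LinearMap.toContinuousLinearMap
        (Matrix.entryLinearMap ℝ ℂ p q))).integrable P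
    refine h1.congr ?_
    filter_upwards [hYG] with ω hω
    rw [hω]
  · simp only [X]
    rw [hexpect]
    exact (hH_herm _).sub hMherm
  · obtain ⟨K, hK⟩ := hhb.2
    refine ⟨K, ?_⟩
    filter_upwards [hXh] with ω hω
    rw [← hω]
    exact hK _
  · have hb : IsBddMeas fun z => (NormedSpace.exp (θ • (G z - M))).trace.re :=
      ((hhb.const_smul θ).matrix_exp).clm traceRe
    have h1 : ∫ ω, (NormedSpace.exp (θ • X ω)).trace.re ∂P =
        ∫ z, (NormedSpace.exp (θ • (G z - M))).trace.re ∂π := by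
      rw [hπdef, integral_map_of_stronglyMeasurable hZm hb.1]
      refine integral_congr_ae ?_
      filter_upwards [hXh] with ω hω
      rw [← hω]
    rw [h1]
    have hherm : ∀ z, (G z - M).IsHermitian := fun z => (hGherm z).sub hMherm
    refine integral_trace_exp_le_of_deriv_le hhb hherm (fun θ hθ => ?_) hθ
    have h0 : ∫ z, (G z - M) ∂π = 0 := by
      rw [integral_sub (hGb.integrable π) (integrable_const M)]
      simp [hM]
    have key := integral_trace_mul_exp_le hπ htv hD1 hDt hhb hherm hA (fun j z w => by
      rw [sub_sub_sub_cancel_right]; exact hGdiff j z w) h0 hθ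
    rwa [← mul_assoc]

theorem corollary12p2 {Ω : Type*} [MeasurableSpace Ω] (P : Measure Ω) [IsProbabilityMeasure P]
    {n d : ℕ} (hd : 1 ≤ d)
    {E : Fin n → Type*} [∀ k, TopologicalSpace (E k)] [∀ k, PolishSpace (E k)]
    [∀ k, MeasurableSpace (E k)] [∀ k, BorelSpace (E k)]
    (Z : ∀ k, Ω → E k) (hZ : ∀ k, Measurable (Z k))
    -- the Dobrushin interdependence matrix
    (D : Matrix (Fin n) (Fin n) ℝ) (hD : IsDobrushinMatrix P Z D)
    (hD_lt : max (inducedNorm 1 D) (inducedNorm ∞ D) < 1)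
    -- `S k` is the set of possible values of `Z k`
    (S : ∀ k, Set (E k)) (hS : ∀ k, MeasurableSet (S k)) (hZS : ∀ k, ∀ᵐ ω ∂P, Z k ω ∈ S k)
    -- the Hermitian matrix-valued function with bounded differences
    (H : (∀ k, E k) → Matrix (Fin d) (Fin d) ℂ) (hH_herm : ∀ z, (H z).IsHermitian)
    (hH_meas : ∀ a b, Measurable fun z => H z a b)
    (A : Fin n → Matrix (Fin d) (Fin d) ℂ) (hA : ∀ j, (A j).IsHermitian)
    (hdiff : ∀ (j : Fin n) (z : ∀ k, E k) (w : E j), (∀ k, z k ∈ S k) → w ∈ S j →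
      (H z - H (Function.update z j w)) ^ 2 ≤ A j ^ 2)
    -- the boundedness and dependence parameters
    (σ b : ℝ) (hσ : 0 ≤ σ) (hσ_sq : σ ^ 2 = specNorm (∑ j, A j ^ 2))
    (hb : b = (1 - 1 / 2 * (inducedNorm 1 D + inducedNorm ∞ D))⁻¹) :
    let Y : Ω → Matrix (Fin d) (Fin d) ℂ := fun ω => H (fun k => Z k ω)
    let X : Ω → Matrix (Fin d) (Fin d) ℂ := fun ω => Y ω - expect P Y
    -- the expectations below exist
    (∀ p q, Integrable (fun ω => Y ω p q) P) ∧
    Integrable (fun ω => lambdaMax (X ω)) P ∧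
    -- the tail bound; for `σ = 0` and `t > 0` its right-hand side means `0`
    (∀ t : ℝ, 0 ≤ t →
      P.real {ω | t ≤ lambdaMax (X ω)} ≤ d * Real.exp (-t ^ 2 / (b * σ ^ 2))) ∧
    (σ = 0 → ∀ t : ℝ, 0 < t → P.real {ω | t ≤ lambdaMax (X ω)} = 0) ∧
    -- the mean bound
    ∫ ω, lambdaMax (X ω) ∂P ≤ σ * Real.sqrt (b * Real.log d) := by
  intro Y X
  have hD1 : inducedNorm 1 D < 1 := (le_max_left _ _).trans_lt hD_lt
  have hDt : inducedNorm ∞ D < 1 := (le_max_right _ _).trans_lt hD_lt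
  obtain ⟨hYint, hXm, hXherm, ⟨K, hK⟩, hmgf⟩ := exists_integral_trace_exp_le P Z hZ D hD hD1 hDt S
    hS hZS H hH_herm hH_meas A hA hdiff
  change StronglyMeasurable X at hXm
  change ∀ ω, (X ω).IsHermitian at hXherm
  have hb' : (1 - (inducedNorm 1 D + inducedNorm ∞ D) / 2)⁻¹ = b := by
    rw [hb]; ring_nf
  have hb0 : 0 < b := by
    rw [← hb']
    exact inv_pos.2 (by linarith)
  rw [hb', ← hσ_sq] at hmgf
  have htail : ∀ θ : ℝ, 0 ≤ θ → ∀ t : ℝ, P.real {ω | t ≤ lambdaMax (X ω)} ≤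
      d * Real.exp (b * σ ^ 2 * θ ^ 2 / 4 - θ * t) := fun θ hθ t =>
    measureReal_lambdaMax_ge_le hd hXm hXherm hK hmgf hθ t
  refine ⟨hYint, integrable_lambdaMax hd hXm hXherm hK, fun t ht => ?_, fun hσ0 t ht => ?_, ?_⟩
  -- For σ = 0 the quotient by zero is 0, so the right side is d and θ = 0 suffices.
  · rcases hσ.eq_or_lt with hσ0 | hσpos
    · have := htail 0 le_rfl t
      simpa [← hσ0] using this
    · have hv : 0 < b * σ ^ 2 := by positivity
      -- This θ minimizes bσ²θ²/4 - θt.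
      refine (htail (2 * t / (b * σ ^ 2)) (by positivity) t).trans (le_of_eq ?_)
      congr 2
      field_simp
      ring
  -- With σ = 0 the tail is at most d e^{-θt} for every θ ≥ 0; let θ → ∞.
  · have hlim : Filter.Tendsto (fun θ : ℝ => d * Real.exp (-(θ * t))) Filter.atTop
        (nhds (d * 0)) :=
      (Real.tendsto_exp_neg_atTop_nhds_zero.comp
        (Filter.tendsto_id.atTop_mul_const ht)).const_mul _
    rw [mul_zero] at hlim
    refine le_antisymm (ge_of_tendsto hlim ?_) measureReal_nonneg
    filter_upwards [Filter.eventually_ge_atTop 0] with θ hθ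
    have := htail θ hθ t
    simpa [hσ0] using this
  · have := integral_lambdaMax_le hd hXm hXherm hK (by positivity) hmgf
    rwa [mul_right_comm, mul_comm _ (σ ^ 2), Real.sqrt_mul (sq_nonneg σ), Real.sqrt_sq hσ] at this
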